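/- **Setting.** Fix integers $d\ge 1$ and $K\ge 1$, side lengths $1=b_1>b_2>\dots>b_K>0$, exponents $0<\alpha_1<\dots<\alpha_K\le 1$, and real numbers $0<\sigma<M$. Put $\mathcal X=[0,1]^d$, $\mathcal Y=[-M,M]$, $B_k=[(1-b_k)/2,(1+b_k)/2]^d$, and $\Delta m_k=b_k^d-b_{k+1}^d$ for $k<K$, $\Delta m_K=b_K^d$. For $f:\mathcal X\to\mathbb R$ and $\Omega\subset\mathcal X$, let $\alpha_{\mathrm{loc}}(\Omega;f)$ be the supremum of all $a\in(0,1]$ for which there is $c>0$ with $|f(x)-f(x')|\le c\|x-x'\|^a$ for all $x,x'\in\Omega$. Let $\mathcal P$ be the class of all laws $\mathrm P$ on $\mathcal X\times\mathcal Y$ of pairs $(X,Y)$ with $Y=f(X)+\varepsilon$, where $X$ is uniform on $\mathcal X$, $\varepsilon$ is independent of $X$ with mean $0$ and variance $\sigma^2$, and $f$ is measurable with $\alpha_{\mathrm{loc}}(B_k;f)=\alpha_k$ for every $k$. For $c_L>0$ let $\mathcal P_{c_L}\subset\mathcal P$ consist of those laws for which, in addition, $|f(x)-f(x')|\le c_L\|x-x'\|^{\alpha_k}$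 for all $x,x'\in B_k$ and all $k$. A random histogram transform with bin width $h>0$ is $H(x)=h^{-1}Rx+b$. Here $b$ is uniform on $[0,1]^d$, and $R$ is independent of $b$ and is the orthogonal factor in the QR decomposition (with positive diagonal of the triangular factor) of a $d\times d$ matrix with independent standard normal entries, its first column being multiplied by $-1$ if $\det R<0$. The bin of $x\in\mathcal X$ is $A_H(x)=\{x'\in\mathcal X:\lfloor H(x')\rfloor=\lfloor H(x)\rfloor\}$ (coordinatewise floor). Given data $D=((X_i,Y_i))_{i=1}^n$, the base regressor is $$f_{\mathrm D,H}(x)=\frac{\sum_{i=1}^n Y_i\mathbf 1_{A_H(x)}(X_i)}{\sum_{i=1}^n \mathbf 1_{A_H(x)}(X_i)}\qquad(\text{with } 0/0:=0).$$ For $T\ge1$ and bin widths $h_1,\dots,h_T>0$, the parallel ensemble of histogram transforms (PEHT) is $f_{\mathrm D,\mathrm E}=\frac1T\sum_{t=1}^T f_{\mathrm D,H_t}$, where $H_1,\dots,H_T$ are independent random histogram transforms, $H_t$ with bin width $h_t$; $\mathrm P_H$ denotes their joint law. Write $\mathcal R_{L,\mathrm P}(g)=\int (y-g(x))^2\,d\mathrm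 P(x,y)$, and let $\mathcal R^*_{L,\mathrm P}$ be its infimum over measurable $g:\mathcal X\to\mathbb R$. **Theorem (lower bound for PEHT).** There is a constant $c_E>0$, independent of $n$ (and of $T$ and the bin widths), such that for every $n\ge1$ $$\inf_{T\ge 1,\ h_1,\dots,h_T>0}\ \sup_{\mathrm P\in\mathcal P}\ \Bigl(\mathbb E_{\mathrm P_H\otimes\mathrm P^n}\,\mathcal R_{L,\mathrm P}(f_{\mathrm D,\mathrm E})-\mathcal R^*_{L,\mathrm P}\Bigr)\ \ge\ c_E\,\inf_{h>0}\Bigl(n^{-1}h^{-d}+\sum_{k=1}^K\Delta m_k\,h^{2\alpha_k}\Bigr).$$ Moreover, for every $c_L>0$ the same holds with $\mathcal P$ replaced by $\mathcal P_{c_L}$, with a constant $c_E>0$ that may also depend on $c_L$. -/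

import Mathlib

open MeasureTheory ProbabilityTheory
open scoped ENNReal

noncomputable section

namespace PEHT

/-- The ambient Euclidean space of the input variable. -/
abbrev Input (d : ℕ) : Type := EuclideanSpace ℝ (Fin d)

/-- The concentric hypercube `[(1 - r) / 2, (1 + r) / 2]^d` of side length `r`. -/
def centeredCube (d : ℕ) (r : ℝ) : Set (Input d) :=
  {x | ∀ i, x i ∈ Set.Icc ((1 - r) / 2) ((1 + r) / 2)}

/-- The input space `[0, 1]^d`. -/
def unitCube (d : ℕ) : Set (Input d) :=
  {x | ∀ i, x i ∈ Set.Icc (0 : ℝ) 1}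

/-! ### Histogram transforms -/

/-- The orthogonal factor `R` of the QR decomposition `G = R W` (with `W` upper triangular with
positive diagonal): its columns are the Gram-Schmidt orthonormalization of the columns of `G`. -/
def qrOrthogonal {d : ℕ} (G : Fin d → Fin d → ℝ) : Matrix (Fin d) (Fin d) ℝ :=
  Matrix.of fun i j =>
    InnerProductSpace.gramSchmidtNormed ℝ
      (fun j' : Fin d => (WithLp.toLp 2 (fun i' => G i' j') : Input d)) j i

/-- The rotation obtained from `G`: the orthogonal factor of its QR decomposition, with the sign
of the first column changed if the determinant is negative. -/
def rotation {d : ℕ} (G : Fin d → Fin d → ℝ) : Matrix (Fin d) (Fin d) ℝ :=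
  Matrix.of fun i j =>
    if (qrOrthogonal G).det < 0 ∧ (j : ℕ) = 0 then -qrOrthogonal G i j else qrOrthogonal G i j

/-- The random source of one histogram transform: a `d × d` matrix and a translation vector. -/
abbrev Seed (d : ℕ) : Type := (Fin d → Fin d → ℝ) × (Fin d → ℝ)

/-- The law of the source of one histogram transform: the matrix has independent standard normal
entries, and the translation vector is independent of it and uniform on `[0, 1]^d`. -/
def seedLaw (d : ℕ) : Measure (Seed d) :=
  (Measure.pi fun _ : Fin d => Measure.pi fun _ : Fin d => gaussianReal 0 1).prod
    ((volume : Measure (Fin d → ℝ)).restrict (Set.Icc 0 1))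

/-- The histogram transform `H(x) = s R x + b` with bin width `h`, i.e. `s = h⁻¹`. -/
def histogramTransform {d : ℕ} (h : ℝ) (ω : Seed d) (x : Input d) : Fin d → ℝ :=
  fun i => h⁻¹ * (rotation ω.1).mulVec x.ofLp i + ω.2 i

/-- The histogram bin `A_H(x)`: all points of `[0, 1]^d` with the same transformed bin index
`⌊H(·)⌋` as `x`. -/
def histogramBin {d : ℕ} (h : ℝ) (ω : Seed d) (x : Input d) : Set (Input d) :=
  {x' | x' ∈ unitCube d ∧
    ∀ i, ⌊histogramTransform h ω x' i⌋ = ⌊histogramTransform h ω x i⌋}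

/-! ### Regressors and risks -/

/-- The base histogram transform regressor: on each bin it is the average of the responses of the
sample points in that bin, and `0` (the value of `0 / 0`) on bins without sample points. -/
def htRegressor {d n : ℕ} (h : ℝ) (ω : Seed d) (D : Fin n → Input d × ℝ) (x : Input d) : ℝ :=
  (∑ i, (D i).2 * (histogramBin h ω x).indicator 1 (D i).1) /
    (∑ i, (histogramBin h ω x).indicator 1 (D i).1)

/-- The parallel ensemble histogram transform with bin widths `h t`, `t : Fin T`. -/
def ensemble {d n T : ℕ} (h : Fin T → ℝ) (ω : Fin T → Seed d) (D : Fin n → Input d × ℝ)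
    (x : Input d) : ℝ :=
  (1 / (T : ℝ)) * ∑ t, htRegressor (h t) (ω t) D x

/-- The least squares risk, with values in `[0, ∞]`. -/
def risk {d : ℕ} (P : Measure (Input d × ℝ)) (g : Input d → ℝ) : ℝ≥0∞ :=
  ∫⁻ z, ENNReal.ofReal ((z.2 - g z.1) ^ 2) ∂P

/-- The Bayes risk: the infimum of the risk over all measurable functions. -/
def bayesRisk {d : ℕ} (P : Measure (Input d × ℝ)) : ℝ≥0∞ :=
  ⨅ (g : Input d → ℝ) (_ : Measurable g), risk P g

/-- The expectation, over the `T` independent histogram transforms and over `n` independent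
observations from `P`, of the risk of the ensemble, minus the Bayes risk. -/
def expectedExcessRisk {d T : ℕ} (n : ℕ) (h : Fin T → ℝ) (P : Measure (Input d × ℝ)) : ℝ≥0∞ :=
  (∫⁻ p : (Fin T → Seed d) × (Fin n → Input d × ℝ), risk P (ensemble h p.1 p.2)
    ∂((Measure.pi fun _ : Fin T => seedLaw d).prod (Measure.pi fun _ : Fin n => P))) - bayesRisk P

/-- The minimax expected excess risk over a class of distributions of all parallel ensembles with
any number `T ≥ 1` of base learners and any positive bin widths. -/
def minimaxRisk {d : ℕ} (n : ℕ) (C : Set (Measure (Input d × ℝ))) : ℝ≥0∞ :=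
  ⨅ (T : ℕ) (_ : 0 < T) (h : Fin T → ℝ) (_ : ∀ t, 0 < h t), ⨆ P ∈ C, expectedExcessRisk n h P

/-! ### Local Hölder continuity -/

/-- `f` is Hölder continuous on `Ω` with exponent `a` and constant `c`. -/
def HolderOn {d : ℕ} (c a : ℝ) (f : Input d → ℝ) (Ω : Set (Input d)) : Prop :=
  ∀ x ∈ Ω, ∀ x' ∈ Ω, |f x - f x'| ≤ c * ‖x - x'‖ ^ a

/-- The local Hölder exponent of `f` on `Ω`: the supremum of all exponents `a ∈ (0, 1]` for which
`f` is Hölder continuous on `Ω` (and `0` if there is none). -/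
def localHolderExponent {d : ℕ} (Ω : Set (Input d)) (f : Input d → ℝ) : ℝ :=
  sSup {a : ℝ | a ∈ Set.Ioc (0 : ℝ) 1 ∧ ∃ c > 0, HolderOn c a f Ω}

/-- `P` is the law of `(X, Y)` for the regression model `Y = f(X) + ε`, where `X` is uniform on
`[0, 1]^d`, the noise `ε` is independent of `X` and has mean zero and variance `σ ^ 2`, and `Y`
takes its values in `[-M, M]`. -/
structure IsRegressionModel {d : ℕ} (M σ : ℝ) (f : Input d → ℝ)
    (P : Measure (Input d × ℝ)) : Prop where
  measurable : Measurable f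
  law : ∃ ν : Measure ℝ, IsProbabilityMeasure ν ∧ MemLp id 2 ν ∧ ∫ e, e ∂ν = 0 ∧
    ∫ e, e ^ 2 ∂ν = σ ^ 2 ∧
    P = (((volume : Measure (Input d)).restrict (unitCube d)).prod ν).map
      (fun p => (p.1, f p.1 + p.2))
  bounded : ∀ᵐ z ∂P, z.2 ∈ Set.Icc (-M) M

/-- The distributions with uniform marginal whose regression function has local Hölder exponent
`α k` on the cube of side length `b k`, for every `k`. -/
def localHolderClass (d : ℕ) {K : ℕ} (b α : Fin K → ℝ) (M σ : ℝ) :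
    Set (Measure (Input d × ℝ)) :=
  {P | ∃ f : Input d → ℝ, IsRegressionModel M σ f P ∧
    ∀ k, localHolderExponent (centeredCube d (b k)) f = α k}

/-- The members of the preceding class whose regression function moreover satisfies, on each cube,
the Hölder condition with the exponent `α k` itself and the prescribed constant `cL`. -/
def localHolderBall (d : ℕ) {K : ℕ} (b α : Fin K → ℝ) (M σ cL : ℝ) :
    Set (Measure (Input d × ℝ)) :=
  {P | ∃ f : Input d → ℝ, IsRegressionModel M σ f P ∧
    (∀ k, localHolderExponent (centeredCube d (b k)) f = α k) ∧
    ∀ k, HolderOn cL (α k) f (centeredCube d (b k))}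

/-- `Δm_k = b_k ^ d - b_{k+1} ^ d`, the volume of the `k`-th cube without the next one; the last
cube is counted in full. -/
def deltaM (d : ℕ) {K : ℕ} (b : Fin K → ℝ) (k : Fin K) : ℝ :=
  b k ^ d - if hk : (k : ℕ) + 1 < K then b ⟨(k : ℕ) + 1, hk⟩ ^ d else 0

/-- The bias-variance trade-off `inf_{h > 0} (n⁻¹ h^{-d} + ∑_k Δm_k h^{2 α_k})`. -/
def tradeOff (d n : ℕ) {K : ℕ} (b α : Fin K → ℝ) : ℝ :=
  ⨅ h : Set.Ioi (0 : ℝ),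
    ((n : ℝ)⁻¹ * ((h : ℝ) ^ d)⁻¹ + ∑ k, deltaM d b k * (h : ℝ) ^ (2 * α k))

end PEHT

end

/-!
The ensemble is a linear estimator: at a point `x` it equals `∑ w_i Y_i` with weights that depend
on the positions `X_1, …, X_n` of the sample points, on the random transforms and on `x`, but not
on the responses (`ensemble_eq_sum`). Integrating out the noise, its expected excess risk for a
regression function `f` is at least the integral over everything else of
`(∑ w_i f(X_i) - f(x)) ^ 2 + σ ^ 2 * ∑ w_i ^ 2`
(`lintegral_conditionalError_le_expectedExcessRisk`). The number of trees
and the bin widths enter only through the weights, and the bound below holds for all weights.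

Perturb a fixed function `f₀` by `∑ τ_k φ_k` with signs `τ_k = ±1` and bumps `φ_k` of disjoint
supports. Averaged over the signs, the first square is at least `(∑ w_i φ_k(X_i) - φ_k(x)) ^ 2`
for each `k`. A linear estimator therefore has to fit the bump `φ_k` at `x` from its values at the
sample points and pays for large weights through the noise; the ridge regression bound
(`ridge_lower_bound`) shows that the error is at least of the order of `φ_k(x) ^ 2` as long as
`∑ φ_k(X_i) ^ 2` is bounded in mean. No information-theoretic argument is needed
(`le_of_forall_sign_expectedExcessRisk_le`).

With bumps of radius `h` and height `h ^ α_1`, where `n * h ^ (2 α_1 + d)` is of order one,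
filling a fixed cube at the margin of `[0, 1]^d` outside the smaller cubes `B_2, …, B_K`, this
gives a lower bound of order `h ^ (2 α_1)`. That is also the order of the trade-off, in which the
smallest exponent dominates (`tradeOff_le`).

It remains to choose `f₀` such that all perturbed functions lie in the class. A small multiple of
`∑_k max(0, r_k - x_1) ^ α_k`, where `x_1 = r_k` is a face of `B_k`, has the required exponents:
on `B_k` the terms of the larger cubes are smooth and those of the smaller cubes are more regular,
and since all terms are monotone they cannot cancel the singularity of the `k`-th one
(`localHolderExponent_faceSum_add`). The bumps vanish near all these faces.
-/

namespace PEHT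

/-! ### The ensemble as a linear estimator with measurable weights -/

theorem measurable_gramSchmidt {ι E : Type*} [LinearOrder ι] [LocallyFiniteOrderBot ι]
    [WellFoundedLT ι] [Countable ι] [NormedAddCommGroup E] [InnerProductSpace ℝ E]
    [MeasurableSpace E] [BorelSpace E] [SecondCountableTopology E] (n : ι) :
    Measurable fun v : ι → E => InnerProductSpace.gramSchmidt ℝ v n := by
  induction n using WellFoundedLT.induction with
  | ind n ih =>
    simp_rw [InnerProductSpace.gramSchmidt_def ℝ _ n, Submodule.starProjection_singleton]
    refine (measurable_pi_apply n).sub (Finset.measurable_sum _ fun i hi => ?_)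
    have hi := ih i (Finset.mem_Iio.1 hi)
    exact ((hi.inner (measurable_pi_apply n)).div (hi.norm.pow_const 2)).smul hi

theorem measurable_qrOrthogonal {d : ℕ} (i j : Fin d) :
    Measurable fun G : Fin d → Fin d → ℝ => qrOrthogonal G i j := by
  simp only [qrOrthogonal, Matrix.of_apply, InnerProductSpace.gramSchmidtNormed]
  have h : Measurable fun G : Fin d → Fin d → ℝ => InnerProductSpace.gramSchmidt ℝ
      (fun j' : Fin d => (WithLp.toLp 2 (fun i' => G i' j') : Input d)) j :=
    (measurable_gramSchmidt j).comp (measurable_pi_lambda _ fun j' => by fun_prop)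
  simp only [PiLp.smul_apply, smul_eq_mul]
  exact h.norm.inv.mul ((by fun_prop : Measurable fun x : Input d => x i).comp h)

theorem measurable_rotation {d : ℕ} (i j : Fin d) :
    Measurable fun G : Fin d → Fin d → ℝ => rotation G i j := by
  have h (i j : Fin d) : Measurable fun G : Fin d → Fin d → ℝ => qrOrthogonal G i j :=
    measurable_qrOrthogonal i j
  have hdet : Measurable fun G : Fin d → Fin d → ℝ => (qrOrthogonal G).det := by
    simp only [Matrix.det_apply]
    fun_prop
  simp only [rotation, Matrix.of_apply]
  by_cases hj : (j : ℕ) = 0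
  · simp only [hj, and_true]
    exact Measurable.ite (measurableSet_lt hdet measurable_const) (h i j).neg (h i j)
  · simpa only [hj, and_false, if_false] using h i j

theorem measurable_histogramTransform {d : ℕ} (h : ℝ) :
    Measurable fun q : Seed d × Input d => histogramTransform h q.1 q.2 := by
  refine measurable_pi_lambda _ fun i => ?_
  have hR (j : Fin d) : Measurable fun q : Seed d × Input d => rotation q.1.1 i j :=
    (measurable_rotation i j).comp (measurable_fst.comp measurable_fst)
  simp only [histogramTransform, Matrix.mulVec, dotProduct]
  fun_prop

theorem measurableSet_unitCube (d : ℕ) : MeasurableSet (unitCube d) := by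
  have : unitCube d = ⋂ i, (fun x : Input d => x i) ⁻¹' Set.Icc (0 : ℝ) 1 := by
    ext x; simp [unitCube]
  rw [this]
  exact MeasurableSet.iInter fun i => (by fun_prop : Measurable fun x : Input d => x i)
    measurableSet_Icc

theorem measurableSet_histogramBin {d : ℕ} (h : ℝ) :
    MeasurableSet {q : Seed d × Input d × Input d | q.2.2 ∈ histogramBin h q.1 q.2.1} := by
  have hx (i : Fin d) : Measurable fun q : Seed d × Input d × Input d =>
      ⌊histogramTransform h q.1 q.2.1 i⌋ :=
    Int.measurable_floor.comp ((measurable_pi_apply i).comp ((measurable_histogramTransform h).comp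
      (measurable_fst.prodMk (measurable_fst.comp measurable_snd))))
  have hx' (i : Fin d) : Measurable fun q : Seed d × Input d × Input d =>
      ⌊histogramTransform h q.1 q.2.2 i⌋ :=
    Int.measurable_floor.comp ((measurable_pi_apply i).comp ((measurable_histogramTransform h).comp
      (measurable_fst.prodMk (measurable_snd.comp measurable_snd))))
  have : {q : Seed d × Input d × Input d | q.2.2 ∈ histogramBin h q.1 q.2.1} =
      (fun q => q.2.2) ⁻¹' unitCube d ∩ ⋂ i, {q | ⌊histogramTransform h q.1 q.2.2 i⌋ =
        ⌊histogramTransform h q.1 q.2.1 i⌋} := by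
    ext q; simp [histogramBin]
  rw [this]
  exact ((measurable_snd.comp measurable_snd) (measurableSet_unitCube d)).inter
    (MeasurableSet.iInter fun i => measurableSet_eq_fun (hx' i) (hx i))

/-- The weight that the ensemble puts at the point `x` on the response of the `i`-th sample point:
it depends on the positions `X` of the sample points but not on the responses. -/
noncomputable def ensembleWeight {d n T : ℕ} (h : Fin T → ℝ) (ω : Fin T → Seed d)
    (X : Fin n → Input d) (x : Input d) (i : Fin n) : ℝ :=
  (1 / (T : ℝ)) * ∑ t, (histogramBin (h t) (ω t) x).indicator 1 (X i) /
    ∑ i', (histogramBin (h t) (ω t) x).indicator (1 : Input d → ℝ) (X i')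

theorem ensemble_eq_sum {d n T : ℕ} (h : Fin T → ℝ) (ω : Fin T → Seed d)
    (D : Fin n → Input d × ℝ) (x : Input d) :
    ensemble h ω D x = ∑ i, ensembleWeight h ω (fun i => (D i).1) x i * (D i).2 := by
  simp only [ensemble, htRegressor, ensembleWeight, Finset.mul_sum, Finset.sum_mul,
    Finset.sum_div]
  rw [Finset.sum_comm]
  refine Finset.sum_congr rfl fun i _ => Finset.sum_congr rfl fun t _ => ?_
  ring

theorem measurable_ensembleWeight {d n T : ℕ} (h : Fin T → ℝ) (i : Fin n) :
    Measurable fun q : (Fin T → Seed d) × (Fin n → Input d) × Input d =>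
      ensembleWeight h q.1 q.2.1 q.2.2 i := by
  have key (t : Fin T) (j : Fin n) :
      Measurable fun q : (Fin T → Seed d) × (Fin n → Input d) × Input d =>
        (histogramBin (h t) (q.1 t) q.2.2).indicator (1 : Input d → ℝ) (q.2.1 j) := by
    have hφ : Measurable fun q : (Fin T → Seed d) × (Fin n → Input d) × Input d =>
        ((q.1 t, q.2.2, q.2.1 j) : Seed d × Input d × Input d) := by fun_prop
    exact (measurable_one.indicator (measurableSet_histogramBin (h t))).comp hφ
  simp only [ensembleWeight]
  fun_prop

/-! ### The excess risk of the ensemble for a single distribution -/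

/-- The uniform distribution on `[0, 1]^d`. -/
noncomputable abbrev uniformLaw (d : ℕ) : Measure (Input d) :=
  (volume : Measure (Input d)).restrict (unitCube d)

instance isProbabilityMeasure_uniformLaw (d : ℕ) : IsProbabilityMeasure (uniformLaw d) := by
  refine ⟨?_⟩
  have h : unitCube d = (MeasurableEquiv.toLp 2 (Fin d → ℝ)).symm ⁻¹' Set.Icc 0 1 := by
    ext x
    simp [unitCube, Set.mem_Icc, Pi.le_def, forall_and]
  rw [Measure.restrict_apply_univ, h,
    (EuclideanSpace.volume_preserving_symm_measurableEquiv_toLp (Fin d)).measure_preimage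
      measurableSet_Icc.nullMeasurableSet]
  simp [Real.volume_Icc_pi]

instance isProbabilityMeasure_seedLaw (d : ℕ) : IsProbabilityMeasure (seedLaw d) := by
  have : IsProbabilityMeasure ((volume : Measure (Fin d → ℝ)).restrict (Set.Icc 0 1)) :=
    ⟨by simp [Real.volume_Icc_pi]⟩
  unfold seedLaw
  infer_instance

/-- The second moment of `c + ∑ w_i ε_i` for independent centred `ε_i` of variance `σ ^ 2`. -/
theorem lintegral_sq_add_sum_noise {n : ℕ} {ν : Measure ℝ} [IsProbabilityMeasure ν] {σ : ℝ}
    (hν : MemLp id 2 ν) (hν1 : ∫ e, e ∂ν = 0) (hν2 : ∫ e, e ^ 2 ∂ν = σ ^ 2)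
    (c : ℝ) (w : Fin n → ℝ) :
    ∫⁻ ε, ENNReal.ofReal ((c + ∑ i, w i * ε i) ^ 2) ∂(Measure.pi fun _ : Fin n => ν) =
      ENNReal.ofReal (c ^ 2 + σ ^ 2 * ∑ i, w i ^ 2) := by
  set π := Measure.pi fun _ : Fin n => ν with hπ
  have hw (i : Fin n) : MemLp (fun e : ℝ => w i * e) 2 ν := hν.const_mul (w i)
  have hwπ (i : Fin n) : MemLp (fun ε : Fin n → ℝ => w i * ε i) 2 π :=
    (hw i).comp_measurePreserving (measurePreserving_eval (fun _ => ν) i)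
  have hS : MemLp (fun ε : Fin n → ℝ => ∑ i, w i * ε i) 2 π := memLp_finsetSum _ fun i _ => hwπ i
  have hmean : ∫ ε, ∑ i, w i * ε i ∂π = 0 := by
    rw [integral_finsetSum _ fun i _ => (hwπ i).integrable one_le_two]
    refine Finset.sum_eq_zero fun i _ => ?_
    rw [integral_const_mul, integral_comp_eval (μ := fun _ : Fin n => ν) (i := i) (f := fun e => e)
      aestronglyMeasurable_id, hν1, mul_zero]
  have hvar : ∫ ε, (∑ i, w i * ε i) ^ 2 ∂π = σ ^ 2 * ∑ i, w i ^ 2 := by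
    have h1 := variance_sum_pi (μ := fun _ : Fin n => ν) (X := fun i e => w i * e) hw
    have h2 : (∑ i, fun ε : Fin n → ℝ => w i * ε i) = fun ε => ∑ i, w i * ε i := by
      ext ε; simp
    rw [h2, variance_eq_integral hS.aemeasurable, hmean] at h1
    simp only [sub_zero] at h1
    rw [h1, Finset.mul_sum]
    refine Finset.sum_congr rfl fun i _ => ?_
    rw [variance_const_mul, variance_eq_integral aemeasurable_id', hν1]
    simp only [sub_zero]
    rw [hν2, mul_comm]
  rw [← ofReal_integral_eq_lintegral_ofReal]
  rotate_left
  · exact ((memLp_const c).add hS).integrable_sq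
  · exact Filter.Eventually.of_forall fun ε => sq_nonneg _
  congr 1
  have hexp : (fun ε : Fin n → ℝ => (c + ∑ i, w i * ε i) ^ 2) =
      fun ε => (c ^ 2 + 2 * c * ∑ i, w i * ε i) + (∑ i, w i * ε i) ^ 2 := by
    ext ε; ring
  have hI := (hS.integrable one_le_two).const_mul (2 * c)
  have hJ : Integrable (fun ε : Fin n → ℝ => c ^ 2 + 2 * c * ∑ i, w i * ε i) π :=
    (integrable_const _).add hI
  rw [hexp, integral_add hJ hS.integrable_sq,
    integral_add (integrable_const _) hI, integral_const_mul, hmean, hvar]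
  simp

/-- The law of `(X, f X + ε)` with `X` uniform on `[0, 1]^d` and independent noise `ε ∼ ν`. -/
noncomputable def regressionLaw {d : ℕ} (f : Input d → ℝ) (ν : Measure ℝ) :
    Measure (Input d × ℝ) :=
  ((uniformLaw d).prod ν).map fun p => (p.1, f p.1 + p.2)

theorem measurable_regressionMap {d : ℕ} {f : Input d → ℝ} (hf : Measurable f) :
    Measurable fun p : Input d × ℝ => (p.1, f p.1 + p.2) := by fun_prop

theorem isProbabilityMeasure_regressionLaw {d : ℕ} {f : Input d → ℝ} (hf : Measurable f)
    (ν : Measure ℝ) [IsProbabilityMeasure ν] : IsProbabilityMeasure (regressionLaw f ν) :=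
  Measure.isProbabilityMeasure_map (measurable_regressionMap hf).aemeasurable

theorem risk_regressionLaw {d : ℕ} {f g : Input d → ℝ} (hf : Measurable f) (hg : Measurable g)
    {ν : Measure ℝ} [IsProbabilityMeasure ν] {σ : ℝ}
    (hν : MemLp id 2 ν) (hν1 : ∫ e, e ∂ν = 0) (hν2 : ∫ e, e ^ 2 ∂ν = σ ^ 2) :
    risk (regressionLaw f ν) g =
      ∫⁻ x, ENNReal.ofReal ((f x - g x) ^ 2) ∂(uniformLaw d) + ENNReal.ofReal (σ ^ 2) := by
  unfold risk regressionLaw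
  rw [lintegral_map (by fun_prop) (measurable_regressionMap hf), lintegral_prod _ (by fun_prop)]
  have h (x : Input d) : ∫⁻ e, ENNReal.ofReal ((f x + e - g x) ^ 2) ∂ν =
      ENNReal.ofReal ((f x - g x) ^ 2) + ENNReal.ofReal (σ ^ 2) := by
    rw [← ENNReal.ofReal_add (sq_nonneg _) (sq_nonneg _)]
    have h1 := lintegral_sq_add_sum_noise hν hν1 hν2 (f x - g x) (fun _ : Fin 1 => 1)
    simp only [one_mul, Finset.univ_unique, Finset.sum_singleton, one_pow, mul_one] at h1
    rw [← h1, ← (measurePreserving_eval (fun _ : Fin 1 => ν) default).map_eq,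
      lintegral_map (by fun_prop) (measurable_pi_apply _)]
    simp only [(measurePreserving_eval (fun _ : Fin 1 => ν) default).map_eq]
    exact lintegral_congr fun ε => by ring_nf
  simp only [h]
  rw [lintegral_add_right _ measurable_const, lintegral_const, measure_univ, mul_one]

/-- A sample from the regression model is the image of independent sample points and noise. -/
theorem pi_regressionLaw {d n : ℕ} {f : Input d → ℝ} (hf : Measurable f)
    (ν : Measure ℝ) [IsProbabilityMeasure ν] :
    (Measure.pi fun _ : Fin n => regressionLaw f ν) =
      ((Measure.pi fun _ : Fin n => uniformLaw d).prod (Measure.pi fun _ : Fin n => ν)).map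
        fun p i => (p.1 i, f (p.1 i) + p.2 i) := by
  have hP := isProbabilityMeasure_regressionLaw hf ν
  unfold regressionLaw at hP ⊢
  rw [← Measure.pi_map_pi (μ := fun _ : Fin n => (uniformLaw d).prod ν)
      fun _ => (measurable_regressionMap hf).aemeasurable,
    ← (measurePreserving_arrowProdEquivProdArrow (Input d) ℝ (Fin n)
      (fun _ => uniformLaw d) (fun _ => ν)).symm.map_eq, Measure.map_map]
  · rfl
  · exact measurable_pi_lambda _ fun i =>
      (measurable_regressionMap hf).comp (measurable_pi_apply i)
  · exact MeasurableEquiv.measurable _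

theorem measurable_ensemble {d n T : ℕ} (h : Fin T → ℝ) :
    Measurable fun q : ((Fin T → Seed d) × (Fin n → Input d × ℝ)) × Input d =>
      ensemble h q.1.1 q.1.2 q.2 := by
  have hφ : Measurable fun q : ((Fin T → Seed d) × (Fin n → Input d × ℝ)) × Input d =>
      ((q.1.1, (fun i => (q.1.2 i).1), q.2) :
        (Fin T → Seed d) × (Fin n → Input d) × Input d) := by fun_prop
  simp only [ensemble_eq_sum]
  refine Finset.measurable_sum _ fun i _ => Measurable.mul ?_ ?_
  · simpa only [Function.comp_def] using (measurable_ensembleWeight (n := n) h i).comp hφ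
  · exact measurable_snd.comp
      ((measurable_pi_apply i).comp (measurable_snd.comp measurable_fst))

/-- The conditional mean squared error at `x`, given the sample points `X`, of the linear estimator
with weights `w`, for the regression function `f` and noise of variance `σ ^ 2`. -/
def conditionalError {d n : ℕ} (σ : ℝ) (f : Input d → ℝ) (w : Fin n → ℝ) (X : Fin n → Input d)
    (x : Input d) : ℝ :=
  (∑ i, w i * f (X i) - f x) ^ 2 + σ ^ 2 * ∑ i, w i ^ 2

theorem measurable_conditionalError {d n T : ℕ} (h : Fin T → ℝ) (σ : ℝ) {f : Input d → ℝ}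
    (hf : Measurable f) :
    Measurable fun q : (Fin T → Seed d) × (Fin n → Input d) × Input d =>
      conditionalError σ f (ensembleWeight h q.1 q.2.1 q.2.2) q.2.1 q.2.2 := by
  have hw := fun i => measurable_ensembleWeight (d := d) (n := n) h i
  unfold conditionalError
  fun_prop

/-- Integrating out the noise in the squared error of a linear estimator. -/
theorem lintegral_linear_estimator {d n : ℕ} {w : (Fin n → Input d) → Input d → Fin n → ℝ}
    (hw : ∀ i, Measurable fun q : (Fin n → Input d) × Input d => w q.1 q.2 i)
    {f : Input d → ℝ} (hf : Measurable f) {ν : Measure ℝ} [IsProbabilityMeasure ν] {σ : ℝ}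
    (hν : MemLp id 2 ν) (hν1 : ∫ e, e ∂ν = 0) (hν2 : ∫ e, e ^ 2 ∂ν = σ ^ 2) :
    ∫⁻ D, ∫⁻ x, ENNReal.ofReal ((f x - ∑ i, w (fun j => (D j).1) x i * (D i).2) ^ 2)
        ∂(uniformLaw d) ∂(Measure.pi fun _ : Fin n => regressionLaw f ν) =
      ∫⁻ X, ∫⁻ x, ENNReal.ofReal (conditionalError σ f (w X x) X x)
        ∂(uniformLaw d) ∂(Measure.pi fun _ : Fin n => uniformLaw d) := by
  have hD : Measurable fun q : (Fin n → Input d × ℝ) × Input d =>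
      ENNReal.ofReal ((f q.2 - ∑ i, w (fun j => (q.1 j).1) q.2 i * (q.1 i).2) ^ 2) := by
    have hφ : Measurable fun q : (Fin n → Input d × ℝ) × Input d =>
        ((fun j => (q.1 j).1, q.2) : (Fin n → Input d) × Input d) := by fun_prop
    have h (i : Fin n) : Measurable fun q : (Fin n → Input d × ℝ) × Input d =>
        w (fun j => (q.1 j).1) q.2 i := (hw i).comp hφ
    fun_prop
  have hXε : Measurable fun q : ((Fin n → Input d) × (Fin n → ℝ)) × Input d =>
      ENNReal.ofReal ((f q.2 - ∑ i, w q.1.1 q.2 i * (f (q.1.1 i) + q.1.2 i)) ^ 2) := by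
    have hφ : Measurable fun q : ((Fin n → Input d) × (Fin n → ℝ)) × Input d =>
        ((q.1.1, q.2) : (Fin n → Input d) × Input d) := by fun_prop
    have h (i : Fin n) : Measurable fun q : ((Fin n → Input d) × (Fin n → ℝ)) × Input d =>
        w q.1.1 q.2 i := (hw i).comp hφ
    fun_prop
  rw [pi_regressionLaw hf ν, lintegral_map hD.lintegral_prod_right' (by fun_prop),
    lintegral_prod _ hXε.lintegral_prod_right'.aemeasurable]
  refine lintegral_congr fun X => ?_
  have hεx : Measurable fun q : (Fin n → ℝ) × Input d =>
      (((X, q.1), q.2) : ((Fin n → Input d) × (Fin n → ℝ)) × Input d) := by fun_prop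
  rw [lintegral_lintegral_swap]
  rotate_left
  · exact (hXε.comp hεx).aemeasurable
  refine lintegral_congr fun x => ?_
  rw [conditionalError, ← lintegral_sq_add_sum_noise hν hν1 hν2]
  refine lintegral_congr fun ε => ?_
  simp only [mul_add, Finset.sum_add_distrib]
  congr 1
  ring

/-- The Bayes risk is at most the noise variance, so the expected excess risk is at least the
integral of the conditional mean squared error. -/
theorem lintegral_conditionalError_le_expectedExcessRisk {d n T : ℕ} (h : Fin T → ℝ)
    {f : Input d → ℝ} (hf : Measurable f) {ν : Measure ℝ} [IsProbabilityMeasure ν] {σ : ℝ}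
    (hν : MemLp id 2 ν) (hν1 : ∫ e, e ∂ν = 0) (hν2 : ∫ e, e ^ 2 ∂ν = σ ^ 2) :
    ∫⁻ ω, ∫⁻ X, ∫⁻ x, ENNReal.ofReal (conditionalError σ f (ensembleWeight h ω X x) X x)
        ∂(uniformLaw d) ∂(Measure.pi fun _ : Fin n => uniformLaw d)
        ∂(Measure.pi fun _ : Fin T => seedLaw d) ≤
      expectedExcessRisk n h (regressionLaw f ν) := by
  have hP := isProbabilityMeasure_regressionLaw hf ν
  have hens := measurable_ensemble (d := d) (n := n) h
  have hbayes : bayesRisk (regressionLaw f ν) ≤ ENNReal.ofReal (σ ^ 2) := by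
    refine (iInf₂_le f hf).trans ?_
    rw [risk_regressionLaw hf hf hν hν1 hν2]
    simp
  unfold expectedExcessRisk
  refine le_trans ?_ (tsub_le_tsub_left hbayes _)
  have hrisk (p : (Fin T → Seed d) × (Fin n → Input d × ℝ)) :
      risk (regressionLaw f ν) (ensemble h p.1 p.2) =
        ∫⁻ x, ENNReal.ofReal ((f x - ensemble h p.1 p.2 x) ^ 2) ∂(uniformLaw d) +
          ENNReal.ofReal (σ ^ 2) :=
    risk_regressionLaw hf (hens.comp (measurable_prodMk_left (x := p))) hν hν1 hν2
  have hint : Measurable fun q : ((Fin T → Seed d) × (Fin n → Input d × ℝ)) × Input d =>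
      ENNReal.ofReal ((f q.2 - ensemble h q.1.1 q.1.2 q.2) ^ 2) :=
    (((hf.comp measurable_snd).sub hens).pow_const 2).ennreal_ofReal
  simp only [hrisk]
  rw [lintegral_add_right _ measurable_const, lintegral_const, measure_univ, mul_one,
    ENNReal.add_sub_cancel_right ENNReal.ofReal_ne_top,
    lintegral_prod _ hint.lintegral_prod_right'.aemeasurable]
  refine lintegral_mono fun ω => le_of_eq ?_
  have hw (i : Fin n) : Measurable fun q : (Fin n → Input d) × Input d =>
      ensembleWeight h ω q.1 q.2 i := by
    have hφ : Measurable fun q : (Fin n → Input d) × Input d => (ω, q) := measurable_prodMk_left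
    simpa only [Function.comp_def] using (measurable_ensembleWeight (n := n) h i).comp hφ
  simp only [ensemble_eq_sum]
  exact (lintegral_linear_estimator (w := ensembleWeight h ω) hw hf hν hν1 hν2).symm

/-! ### Averaging over random signs -/

/-- Flipping the `j`-th sign splits off the square of the coefficient of that sign, so the mean of
the squares of `A + ∑ τ_k B_k` over all sign vectors is at least `B_j ^ 2`. -/
theorem card_mul_sq_le_sum_sign {ι : Type*} [Fintype ι] [DecidableEq ι] (A : ℝ) (B : ι → ℝ)
    (j : ι) :
    (Fintype.card (ι → ℤˣ) : ℝ) * B j ^ 2 ≤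
      ∑ τ : ι → ℤˣ, (A + ∑ k, ((τ k : ℤ) : ℝ) * B k) ^ 2 := by
  set g : (ι → ℤˣ) → ℝ := fun τ => (A + ∑ k, ((τ k : ℤ) : ℝ) * B k) ^ 2 with hg
  have hinv : Function.Involutive fun τ : ι → ℤˣ => Function.update τ j (-τ j) := by
    intro τ; simp
  have hsum : ∑ τ, g (Function.update τ j (-τ j)) = ∑ τ, g τ :=
    Equiv.sum_comp hinv.toPerm g
  have hpair (τ : ι → ℤˣ) : 2 * B j ^ 2 ≤ g τ + g (Function.update τ j (-τ j)) := by
    have h1 : ∑ k, ((τ k : ℤ) : ℝ) * B k =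
        ((τ j : ℤ) : ℝ) * B j + ∑ k ∈ Finset.univ.erase j, ((τ k : ℤ) : ℝ) * B k :=
      (Finset.add_sum_erase _ _ (Finset.mem_univ j)).symm
    have h2 : ∑ k, ((Function.update τ j (-τ j) k : ℤ) : ℝ) * B k =
        -(((τ j : ℤ) : ℝ) * B j) + ∑ k ∈ Finset.univ.erase j, ((τ k : ℤ) : ℝ) * B k := by
      rw [← Finset.add_sum_erase _ _ (Finset.mem_univ j)]
      congr 1
      · simp
      · refine Finset.sum_congr rfl fun k hk => ?_
        rw [Function.update_of_ne (Finset.ne_of_mem_erase hk)]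
    have h3 : (((τ j : ℤ) : ℝ) * B j) ^ 2 = B j ^ 2 := by
      rcases Int.units_eq_one_or (τ j) with h | h <;> simp [h]
    simp only [hg, h1, h2]
    nlinarith [sq_nonneg (A + ∑ k ∈ Finset.univ.erase j, ((τ k : ℤ) : ℝ) * B k)]
  have := Finset.sum_le_sum fun τ (_ : τ ∈ Finset.univ) => hpair τ
  rw [Finset.sum_add_distrib, hsum, Finset.sum_const, nsmul_eq_mul, Finset.card_univ] at this
  linarith

/-- The bias-variance trade-off for weights `w` and a signal `v` that is to be fitted to the value
`a`. The right-hand side is, for every `s`, a tangent to the minimum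
`a ^ 2 * σ ^ 2 / (σ ^ 2 + ‖v‖ ^ 2)` over all `w`; it is affine in `‖v‖ ^ 2`, so that it can be
integrated directly. -/
theorem ridge_lower_bound {ι : Type*} [Fintype ι] (w v : ι → ℝ) (a s σ : ℝ) (hσ : 0 < σ) :
    a ^ 2 * (2 * s - s ^ 2 * (1 + (∑ i, v i ^ 2) / σ ^ 2)) ≤
      (∑ i, w i * v i - a) ^ 2 + σ ^ 2 * ∑ i, w i ^ 2 := by
  have h1 : 0 ≤ ∑ i, (σ * w i - s * a * v i / σ) ^ 2 := Finset.sum_nonneg fun i _ => sq_nonneg _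
  have h2 : ∑ i, (σ * w i - s * a * v i / σ) ^ 2 =
      σ ^ 2 * ∑ i, w i ^ 2 - 2 * s * a * ∑ i, w i * v i +
        s ^ 2 * a ^ 2 * ((∑ i, v i ^ 2) / σ ^ 2) := by
    simp only [Finset.mul_sum, Finset.sum_div, ← Finset.sum_sub_distrib,
      ← Finset.sum_add_distrib]
    refine Finset.sum_congr rfl fun i _ => ?_
    field_simp
    ring
  nlinarith [sq_nonneg (∑ i, w i * v i - a + s * a)]

/-- The average over all signs of the conditional mean squared error of a linear estimator at a
point `x`, where at most one of the bumps `φ k` is nonzero. -/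
theorem sum_sign_error_lower_bound {ι κ β : Type*} [Fintype ι] [DecidableEq ι] [Fintype κ]
    (w : κ → ℝ) (X : κ → β) (x : β) (f₀ : β → ℝ) (φ : ι → β → ℝ) (s σ : ℝ) (hσ : 0 < σ)
    (hφ : ∀ j k, φ j x ≠ 0 → φ k x ≠ 0 → j = k) :
    (Fintype.card (ι → ℤˣ) : ℝ) *
        ∑ j, φ j x ^ 2 * (2 * s - s ^ 2 * (1 + (∑ i, φ j (X i) ^ 2) / σ ^ 2)) ≤
      ∑ τ : ι → ℤˣ, ((∑ i, w i * (f₀ (X i) + ∑ k, ((τ k : ℤ) : ℝ) * φ k (X i)) -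
        (f₀ x + ∑ k, ((τ k : ℤ) : ℝ) * φ k x)) ^ 2 + σ ^ 2 * ∑ i, w i ^ 2) := by
  by_cases h : ∃ j, φ j x ≠ 0
  · obtain ⟨j, hj⟩ := h
    rw [Finset.sum_eq_single j]
    rotate_left
    · intro k _ hk
      have : φ k x = 0 := by
        by_contra h'
        exact hk (hφ k j h' hj)
      simp [this]
    · simp
    have hlin (τ : ι → ℤˣ) : ∑ i, w i * (f₀ (X i) + ∑ k, ((τ k : ℤ) : ℝ) * φ k (X i)) -
        (f₀ x + ∑ k, ((τ k : ℤ) : ℝ) * φ k x) = (∑ i, w i * f₀ (X i) - f₀ x) +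
          ∑ k, ((τ k : ℤ) : ℝ) * (∑ i, w i * φ k (X i) - φ k x) := by
      have : ∑ i, w i * ∑ k, ((τ k : ℤ) : ℝ) * φ k (X i) =
          ∑ k, ((τ k : ℤ) : ℝ) * ∑ i, w i * φ k (X i) := by
        simp only [Finset.mul_sum]
        rw [Finset.sum_comm]
        exact Finset.sum_congr rfl fun k _ => Finset.sum_congr rfl fun i _ => by ring
      simp only [mul_add, mul_sub, Finset.sum_add_distrib, Finset.sum_sub_distrib, this]
      ring
    simp only [hlin, Finset.sum_add_distrib, Finset.sum_const, nsmul_eq_mul, Finset.card_univ]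
    have h1 := card_mul_sq_le_sum_sign (∑ i, w i * f₀ (X i) - f₀ x)
      (fun k => ∑ i, w i * φ k (X i) - φ k x) j
    have h2 := ridge_lower_bound w (fun i => φ j (X i)) (φ j x) s σ hσ
    have h3 : (0 : ℝ) ≤ Fintype.card (ι → ℤˣ) := Nat.cast_nonneg _
    nlinarith [mul_le_mul_of_nonneg_left h2 h3]
  · push Not at h
    simp only [h, ne_eq, OfNat.ofNat_ne_zero, not_false_eq_true, zero_pow, zero_mul,
      Finset.sum_const_zero, mul_zero]
    positivity

/-! ### The lower bound for a family of perturbed regression functions -/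

theorem ofReal_integral_le_lintegral_ofReal {α : Type*} [MeasurableSpace α] {μ : Measure α}
    (f : α → ℝ) : ENNReal.ofReal (∫ x, f x ∂μ) ≤ ∫⁻ x, ENNReal.ofReal (f x) ∂μ := by
  by_cases hf : Integrable f μ
  · calc ENNReal.ofReal (∫ x, f x ∂μ) ≤ ENNReal.ofReal (∫ x, max (f x) 0 ∂μ) :=
        ENNReal.ofReal_le_ofReal (integral_mono hf hf.pos_part fun x => le_max_left _ _)
      _ = ∫⁻ x, ENNReal.ofReal (max (f x) 0) ∂μ :=
        ofReal_integral_eq_lintegral_ofReal hf.pos_part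
          (Filter.Eventually.of_forall fun x => le_max_right _ _)
      _ = ∫⁻ x, ENNReal.ofReal (f x) ∂μ := by simp [ENNReal.ofReal_max]
  · simp [integral_undef hf]

/-- The lower bound of the averaged conditional error, integrated over the sample points and the
query point. -/
theorem integral_sign_error {d n : ℕ} {ι : Type*} [Fintype ι] {φ : ι → Input d → ℝ}
    (hφ : ∀ j, Integrable (fun x => φ j x ^ 2) (uniformLaw d)) (N s σ : ℝ) :
    ∫ X, ∫ x, N * ∑ j, φ j x ^ 2 * (2 * s - s ^ 2 * (1 + (∑ i, φ j (X i) ^ 2) / σ ^ 2))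
        ∂(uniformLaw d) ∂(Measure.pi fun _ : Fin n => uniformLaw d) =
      N * ∑ j, (∫ x, φ j x ^ 2 ∂(uniformLaw d)) *
        (2 * s - s ^ 2 * (1 + n * (∫ x, φ j x ^ 2 ∂(uniformLaw d)) / σ ^ 2)) := by
  set I : ι → ℝ := fun j => ∫ x, φ j x ^ 2 ∂(uniformLaw d) with hI
  have hx (X : Fin n → Input d) :
      ∫ x, N * ∑ j, φ j x ^ 2 * (2 * s - s ^ 2 * (1 + (∑ i, φ j (X i) ^ 2) / σ ^ 2))
        ∂(uniformLaw d) =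
      N * ∑ j, I j * (2 * s - s ^ 2 * (1 + (∑ i, φ j (X i) ^ 2) / σ ^ 2)) := by
    rw [integral_const_mul, integral_finsetSum _ fun j _ => (hφ j).mul_const _]
    simp only [integral_mul_const, hI]
  have hXi (j : ι) (i : Fin n) : Integrable (fun X : Fin n → Input d => φ j (X i) ^ 2)
      (Measure.pi fun _ => uniformLaw d) :=
    (measurePreserving_eval (fun _ => uniformLaw d) i).integrable_comp_of_integrable (hφ j)
  have hX (j : ι) : ∫ X, (∑ i, φ j (X i) ^ 2) ∂(Measure.pi fun _ : Fin n => uniformLaw d) =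
      n * I j := by
    rw [integral_finsetSum _ fun i _ => hXi j i]
    have (i : Fin n) := integral_comp_eval (μ := fun _ : Fin n => uniformLaw d) (i := i)
      (hφ j).aestronglyMeasurable
    simp [this, hI]
  have hS (j : ι) : Integrable (fun X : Fin n → Input d => (∑ i, φ j (X i) ^ 2) / σ ^ 2)
      (Measure.pi fun _ => uniformLaw d) := (integrable_finsetSum _ fun i _ => hXi j i).div_const _
  have hS1 (j : ι) : Integrable
      (fun X : Fin n → Input d => s ^ 2 * (1 + (∑ i, φ j (X i) ^ 2) / σ ^ 2))
      (Measure.pi fun _ => uniformLaw d) := ((integrable_const _).add (hS j)).const_mul _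
  simp only [hx]
  rw [integral_const_mul, integral_finsetSum]
  rotate_left
  · exact fun j _ => ((integrable_const _).sub (hS1 j)).const_mul _
  congr 1
  refine Finset.sum_congr rfl fun j _ => ?_
  rw [integral_const_mul, integral_sub (integrable_const _) (hS1 j), integral_const_mul (s ^ 2),
    integral_add (integrable_const _) (hS j), integral_div, hX]
  simp [hI]

/-- If the regression functions `f₀ + ∑ τ_k φ_k`, with disjointly supported bumps `φ_k` and signs
`τ_k = ±1`, cannot be told apart well because the bumps are small in mean square (`n * E φ_k ^ 2 ≤
V * σ ^ 2`), then the worst expected excess risk over all signs is at least of the order of the mean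
square of `∑ φ_k`. -/
theorem le_of_forall_sign_expectedExcessRisk_le {d n T : ℕ} (h : Fin T → ℝ) {σ : ℝ} (hσ : 0 < σ)
    {ν : Measure ℝ} [IsProbabilityMeasure ν] (hν : MemLp id 2 ν) (hν1 : ∫ e, e ∂ν = 0)
    (hν2 : ∫ e, e ^ 2 ∂ν = σ ^ 2) {ι : Type*} [Fintype ι] [DecidableEq ι]
    {f₀ : Input d → ℝ} (hf₀ : Measurable f₀) {φ : ι → Input d → ℝ} (hφ : ∀ j, Measurable (φ j))
    (hφI : ∀ j, Integrable (fun x => φ j x ^ 2) (uniformLaw d))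
    (hdisj : ∀ x j k, φ j x ≠ 0 → φ k x ≠ 0 → j = k) {V Ilo : ℝ} (hV : 0 ≤ V)
    (hlo : ∀ j, Ilo ≤ ∫ x, φ j x ^ 2 ∂(uniformLaw d))
    (hhi : ∀ j, n * ∫ x, φ j x ^ 2 ∂(uniformLaw d) ≤ V * σ ^ 2) {S : ℝ≥0∞}
    (hS : ∀ τ : ι → ℤˣ, expectedExcessRisk n h
      (regressionLaw (fun x => f₀ x + ∑ k, ((τ k : ℤ) : ℝ) * φ k x) ν) ≤ S) :
    ENNReal.ofReal (Fintype.card ι * Ilo / (1 + V)) ≤ S := by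
  set f : (ι → ℤˣ) → Input d → ℝ := fun τ x => f₀ x + ∑ k, ((τ k : ℤ) : ℝ) * φ k x with hf_def
  have hf (τ : ι → ℤˣ) : Measurable (f τ) := by fun_prop
  set Q := Measure.pi fun _ : Fin T => seedLaw d
  set π := Measure.pi fun _ : Fin n => uniformLaw d
  obtain ⟨N, hN_def⟩ : ∃ N : ℝ, N = Fintype.card (ι → ℤˣ) := ⟨_, rfl⟩
  have hN : 0 < N := hN_def ▸ Nat.cast_pos.2 Fintype.card_pos
  set s : ℝ := (1 + V)⁻¹ with hs_def
  have hs : 0 < s := by positivity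
  have hmeas (τ : ι → ℤˣ) := (measurable_conditionalError (n := n) h σ (hf τ)).ennreal_ofReal
  have hτ (τ : ι → ℤˣ) : ∫⁻ q, ENNReal.ofReal
      (conditionalError σ (f τ) (ensembleWeight h q.1 q.2.1 q.2.2) q.2.1 q.2.2)
        ∂(Q.prod (π.prod (uniformLaw d))) ≤ S := by
    refine le_trans (le_of_eq ?_) ((lintegral_conditionalError_le_expectedExcessRisk h (hf τ)
      hν hν1 hν2).trans (hS τ))
    rw [lintegral_prod _ (hmeas τ).aemeasurable]
    refine lintegral_congr fun ω => ?_
    rw [lintegral_prod]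
    exact ((hmeas τ).comp (measurable_prodMk_left (x := ω))).aemeasurable
  have hsum : ∑ τ : ι → ℤˣ, ∫⁻ q, ENNReal.ofReal
      (conditionalError σ (f τ) (ensembleWeight h q.1 q.2.1 q.2.2) q.2.1 q.2.2)
        ∂(Q.prod (π.prod (uniformLaw d))) ≤ ENNReal.ofReal N * S := by
    refine (Finset.sum_le_sum fun τ _ => hτ τ).trans (le_of_eq ?_)
    rw [Finset.sum_const, nsmul_eq_mul, hN_def, ENNReal.ofReal_natCast, Finset.card_univ]
  rw [← lintegral_finsetSum _ fun τ _ => hmeas τ] at hsum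
  set Ψ : (Fin n → Input d) × Input d → ℝ := fun q =>
    N * ∑ j, φ j q.2 ^ 2 * (2 * s - s ^ 2 * (1 + (∑ i, φ j (q.1 i) ^ 2) / σ ^ 2)) with hΨ_def
  have hΨ : Measurable Ψ := by fun_prop
  -- The lower bound `Ψ` no longer involves the weights, hence neither the transforms.
  have hpoint (q : (Fin T → Seed d) × (Fin n → Input d) × Input d) :
      ENNReal.ofReal (Ψ q.2) ≤ ∑ τ : ι → ℤˣ, ENNReal.ofReal
        (conditionalError σ (f τ) (ensembleWeight h q.1 q.2.1 q.2.2) q.2.1 q.2.2) := by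
    rw [← ENNReal.ofReal_sum_of_nonneg fun τ _ => by unfold conditionalError; positivity]
    rw [hΨ_def, hN_def]
    exact ENNReal.ofReal_le_ofReal
      (sum_sign_error_lower_bound _ q.2.1 q.2.2 f₀ φ s σ hσ (hdisj q.2.2))
  have hΨS : ENNReal.ofReal (∫ X, ∫ x, Ψ (X, x) ∂(uniformLaw d) ∂π) ≤ ENNReal.ofReal N * S := by
    calc ENNReal.ofReal (∫ X, ∫ x, Ψ (X, x) ∂(uniformLaw d) ∂π)
        ≤ ∫⁻ X, ∫⁻ x, ENNReal.ofReal (Ψ (X, x)) ∂(uniformLaw d) ∂π :=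
          (ofReal_integral_le_lintegral_ofReal _).trans
            (lintegral_mono fun X => ofReal_integral_le_lintegral_ofReal _)
      _ = ∫⁻ q, ENNReal.ofReal (Ψ q.2) ∂(Q.prod (π.prod (uniformLaw d))) := by
          rw [lintegral_prod _ (by fun_prop)]
          simp only [lintegral_const, measure_univ, mul_one]
          rw [lintegral_prod _ (by fun_prop)]
      _ ≤ _ := (lintegral_mono hpoint).trans hsum
  rw [hΨ_def, integral_sign_error hφI] at hΨS
  have hterm (j : ι) : Ilo * s ≤ (∫ x, φ j x ^ 2 ∂(uniformLaw d)) *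
      (2 * s - s ^ 2 * (1 + n * (∫ x, φ j x ^ 2 ∂(uniformLaw d)) / σ ^ 2)) := by
    have h0 : 0 ≤ ∫ x, φ j x ^ 2 ∂(uniformLaw d) := integral_nonneg fun x => sq_nonneg _
    have h1 : n * (∫ x, φ j x ^ 2 ∂(uniformLaw d)) / σ ^ 2 ≤ V :=
      (div_le_iff₀ (by positivity)).2 (hhi j)
    have h2 : s * (1 + V) = 1 := inv_mul_cancel₀ (by positivity)
    have h3 : s ≤ 2 * s - s ^ 2 * (1 + n * (∫ x, φ j x ^ 2 ∂(uniformLaw d)) / σ ^ 2) := by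
      have := mul_le_mul_of_nonneg_left h1 (sq_nonneg s)
      nlinarith
    exact (mul_le_mul_of_nonneg_right (hlo j) hs.le).trans (mul_le_mul_of_nonneg_left h3 h0)
  have htotal : N * (Fintype.card ι * Ilo / (1 + V)) ≤
      N * ∑ j, (∫ x, φ j x ^ 2 ∂(uniformLaw d)) *
        (2 * s - s ^ 2 * (1 + n * (∫ x, φ j x ^ 2 ∂(uniformLaw d)) / σ ^ 2)) := by
    refine mul_le_mul_of_nonneg_left ?_ hN.le
    refine le_trans (le_of_eq ?_) (Finset.sum_le_sum fun j _ => hterm j)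
    rw [Finset.sum_const, nsmul_eq_mul, Finset.card_univ, hs_def, div_eq_mul_inv, mul_assoc]
  have := (ENNReal.ofReal_le_ofReal htotal).trans hΨS
  rw [ENNReal.ofReal_mul hN.le] at this
  exact (ENNReal.mul_le_mul_iff_right (ENNReal.ofReal_pos.2 hN).ne' ENNReal.ofReal_ne_top).1 this

/-! ### Bumps on a lattice of disjoint balls -/

/-- A bounded Lipschitz function is Hölder continuous: the two bounds `A * h ^ a` and
`A * h ^ (a - 1) * t` on the oscillation interpolate to `A * t ^ a`. -/
theorem le_mul_rpow_of_le_of_le {A h a t y : ℝ} (hA : 0 ≤ A) (hh : 0 < h) (ha : 0 ≤ a)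
    (ha1 : a ≤ 1) (ht : 0 ≤ t) (h1 : y ≤ A * h ^ a) (h2 : y ≤ A * h ^ (a - 1) * t) :
    y ≤ A * t ^ a := by
  rcases le_total h t with hht | hth
  · exact h1.trans (mul_le_mul_of_nonneg_left (Real.rpow_le_rpow hh.le hht ha) hA)
  · rcases ht.eq_or_lt with rfl | ht
    · rw [mul_zero] at h2
      exact h2.trans (mul_nonneg hA (Real.rpow_nonneg le_rfl _))
    · have h3 : h ^ (a - 1) ≤ t ^ (a - 1) :=
        Real.rpow_le_rpow_of_nonpos ht hth (by linarith)
      calc y ≤ A * h ^ (a - 1) * t := h2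
        _ ≤ A * t ^ (a - 1) * t := by gcongr
        _ = A * t ^ a := by
          rw [mul_assoc, ← Real.rpow_add_one ht.ne']; simp

/-- The cone-shaped bump of radius `h` and height `L * h ^ a` around `z`. -/
noncomputable def bump {d : ℕ} (L a h : ℝ) (z x : Input d) : ℝ :=
  L * h ^ (a - 1) * max 0 (h - ‖x - z‖)

section Bump

variable {d : ℕ} {L a h : ℝ}

theorem continuous_bump (z : Input d) : Continuous (bump L a h z) := by
  unfold bump
  fun_prop

theorem norm_sub_lt_of_bump_ne_zero {z x : Input d} (hx : bump L a h z x ≠ 0) : ‖x - z‖ < h := by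
  by_contra hc
  exact hx (by rw [bump, max_eq_left (by linarith), mul_zero])

theorem bump_nonneg (hL : 0 ≤ L) (hh : 0 < h) (z x : Input d) : 0 ≤ bump L a h z x := by
  unfold bump
  positivity

theorem bump_le (hL : 0 ≤ L) (hh : 0 < h) (z x : Input d) : bump L a h z x ≤ L * h ^ a := by
  have h1 : h ^ a = h ^ (a - 1) * h := by rw [← Real.rpow_add_one hh.ne']; simp
  rw [bump, h1, ← mul_assoc]
  exact mul_le_mul_of_nonneg_left (max_le hh.le (by linarith [norm_nonneg (x - z)]))
    (by positivity)

theorem abs_bump_sub_le_mul_norm (hL : 0 ≤ L) (hh : 0 < h) (z x y : Input d) :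
    |bump L a h z x - bump L a h z y| ≤ L * h ^ (a - 1) * ‖x - y‖ := by
  have h0 : 0 ≤ L * h ^ (a - 1) := by positivity
  rw [bump, bump, ← mul_sub, abs_mul, abs_of_nonneg h0]
  refine mul_le_mul_of_nonneg_left ?_ h0
  refine (abs_max_sub_max_le_max _ _ _ _).trans (max_le (by simp) ?_)
  rw [sub_sub_sub_cancel_left, abs_sub_comm]
  simpa using abs_norm_sub_norm_le (x - z) (y - z)

theorem abs_bump_sub_le_rpow (hL : 0 ≤ L) (hh : 0 < h) (ha : 0 ≤ a) (ha1 : a ≤ 1)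
    (z x y : Input d) : |bump L a h z x - bump L a h z y| ≤ L * ‖x - y‖ ^ a := by
  refine le_mul_rpow_of_le_of_le hL hh ha ha1 (norm_nonneg _) ?_
    (abs_bump_sub_le_mul_norm hL hh z x y)
  exact abs_sub_le_of_nonneg_of_le (bump_nonneg hL hh z x) (bump_le hL hh z x)
    (bump_nonneg hL hh z y) (bump_le hL hh z y)

theorem integrable_bump_sq (hL : 0 ≤ L) (hh : 0 < h) (z : Input d) :
    Integrable (fun x => bump L a h z x ^ 2) (uniformLaw d) := by
  refine Integrable.of_bound ((continuous_bump z).pow 2).aestronglyMeasurable ((L * h ^ a) ^ 2)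
    (Filter.Eventually.of_forall fun x => ?_)
  rw [Real.norm_of_nonneg (sq_nonneg _)]
  exact pow_le_pow_left₀ (bump_nonneg hL hh z x) (bump_le hL hh z x) 2

/-- The volume of the unit ball. -/
noncomputable def ballVolume (d : ℕ) : ℝ := volume.real (Metric.ball (0 : Input d) 1)

theorem ballVolume_pos (d : ℕ) : 0 < ballVolume d :=
  ENNReal.toReal_pos (Metric.measure_ball_pos _ _ one_pos).ne' measure_ball_lt_top.ne

theorem volume_real_ball (hd : 0 < d) (z : Input d) {r : ℝ} (hr : 0 ≤ r) :
    volume.real (Metric.ball z r) = r ^ d * ballVolume d := by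
  have : Nonempty (Fin d) := ⟨⟨0, hd⟩⟩
  rw [Measure.real, Measure.addHaar_ball _ _ hr, ENNReal.toReal_mul,
    ENNReal.toReal_ofReal (by positivity), finrank_euclideanSpace_fin]
  rfl

theorem integral_bump_sq_le (hd : 0 < d) (hL : 0 ≤ L) (hh : 0 < h) (z : Input d) :
    ∫ x, bump L a h z x ^ 2 ∂(uniformLaw d) ≤ (L * h ^ a) ^ 2 * (h ^ d * ballVolume d) := by
  have h1 : ∫ x, bump L a h z x ^ 2 ∂(uniformLaw d) ≤
      ∫ x, (Metric.ball z h).indicator (fun _ => (L * h ^ a) ^ 2) x ∂(uniformLaw d) := by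
    refine integral_mono (integrable_bump_sq hL hh z)
      ((integrable_const _).indicator measurableSet_ball) fun x => ?_
    by_cases hx : bump L a h z x = 0
    · simp only [hx, ne_eq, OfNat.ofNat_ne_zero, not_false_eq_true, zero_pow]
      exact Set.indicator_nonneg (fun _ _ => sq_nonneg _) _
    · rw [Set.indicator_of_mem (by
        rw [mem_ball_iff_norm]; exact norm_sub_lt_of_bump_ne_zero hx)]
      exact pow_le_pow_left₀ (bump_nonneg hL hh z x) (bump_le hL hh z x) 2
  refine h1.trans ?_
  rw [integral_indicator_const _ measurableSet_ball, smul_eq_mul, mul_comm]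
  refine mul_le_mul_of_nonneg_left ?_ (sq_nonneg _)
  rw [← volume_real_ball hd z hh.le]
  exact ENNReal.toReal_mono measure_ball_lt_top.ne (Measure.restrict_apply_le _ _)

theorem le_integral_bump_sq (hd : 0 < d) (hL : 0 ≤ L) (hh : 0 < h) {z : Input d}
    (hz : Metric.ball z h ⊆ unitCube d) :
    (L * h ^ a / 2) ^ 2 * ((h / 2) ^ d * ballVolume d) ≤
      ∫ x, bump L a h z x ^ 2 ∂(uniformLaw d) := by
  have h1 : ∫ x, (Metric.ball z (h / 2)).indicator (fun _ => (L * h ^ a / 2) ^ 2) x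
      ∂(uniformLaw d) ≤ ∫ x, bump L a h z x ^ 2 ∂(uniformLaw d) := by
    refine integral_mono ((integrable_const _).indicator measurableSet_ball)
      (integrable_bump_sq hL hh z) fun x => ?_
    by_cases hx : x ∈ Metric.ball z (h / 2)
    · rw [Set.indicator_of_mem hx]
      rw [mem_ball_iff_norm] at hx
      refine pow_le_pow_left₀ (by positivity) ?_ 2
      have h2 : h ^ a = h ^ (a - 1) * h := by rw [← Real.rpow_add_one hh.ne']; simp
      have h3 : h / 2 ≤ max 0 (h - ‖x - z‖) := le_max_of_le_right (by linarith)
      calc L * h ^ a / 2 = L * h ^ (a - 1) * (h / 2) := by rw [h2]; ring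
        _ ≤ _ := mul_le_mul_of_nonneg_left h3 (by positivity)
    · rw [Set.indicator_of_notMem hx]
      exact sq_nonneg _
  refine le_trans (le_of_eq ?_) h1
  rw [integral_indicator_const _ measurableSet_ball, smul_eq_mul, mul_comm,
    ← volume_real_ball hd z (by positivity : 0 ≤ h / 2)]
  congr 1
  rw [Measure.real, Measure.real, Measure.restrict_apply measurableSet_ball,
    Set.inter_eq_left.2 ((Metric.ball_subset_ball (by linarith)).trans hz)]

/-- The centre of the cell with index `k` in the partition of `[0, 2 * m * h]^d` into `m ^ d` cubes
of side length `2 * h`. -/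
noncomputable def gridCentre {d m : ℕ} (h : ℝ) (k : Fin d → Fin m) : Input d :=
  WithLp.toLp 2 fun i => (2 * ((k i : ℕ) : ℝ) + 1) * h

theorem mem_Ioo_of_norm_sub_gridCentre_lt {m : ℕ} {k : Fin d → Fin m} {x : Input d}
    (hx : ‖x - gridCentre h k‖ < h) (i : Fin d) :
    x i ∈ Set.Ioo (2 * ((k i : ℕ) : ℝ) * h) (2 * (((k i : ℕ) : ℝ) + 1) * h) := by
  have h1 : |x i - (2 * ((k i : ℕ) : ℝ) + 1) * h| < h := by
    refine lt_of_le_of_lt ?_ hx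
    simpa [gridCentre] using PiLp.norm_apply_le (x - gridCentre h k) i
  rw [abs_lt] at h1
  constructor <;> linarith

theorem mem_Ioo_zero_of_norm_sub_gridCentre_lt {m : ℕ} (hh : 0 < h) {k : Fin d → Fin m}
    {x : Input d} (hx : ‖x - gridCentre h k‖ < h) (i : Fin d) : x i ∈ Set.Ioo 0 (2 * m * h) := by
  obtain ⟨h1, h2⟩ := mem_Ioo_of_norm_sub_gridCentre_lt hx i
  have h3 : (((k i : ℕ) : ℝ) + 1) ≤ m := by exact_mod_cast (k i).isLt
  refine ⟨lt_of_le_of_lt (by positivity) h1, h2.trans_le ?_⟩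
  gcongr

theorem gridCentre_disjoint {m : ℕ} (hh : 0 < h) (x : Input d) (j k : Fin d → Fin m)
    (hj : ‖x - gridCentre h j‖ < h) (hk : ‖x - gridCentre h k‖ < h) : j = k := by
  have key (j k : Fin d → Fin m) (hj : ‖x - gridCentre h j‖ < h)
      (hk : ‖x - gridCentre h k‖ < h) (i : Fin d) : (j i : ℕ) ≤ k i := by
    have h1 := (mem_Ioo_of_norm_sub_gridCentre_lt hj i).1
    have h2 := (mem_Ioo_of_norm_sub_gridCentre_lt hk i).2
    have h3 : ((j i : ℕ) : ℝ) < (k i : ℕ) + 1 := by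
      have := h1.trans h2
      have : ((j i : ℕ) : ℝ) * (2 * h) < ((k i : ℕ) + 1) * (2 * h) := by linarith
      exact lt_of_mul_lt_mul_right this (by positivity)
    exact Nat.lt_succ_iff.1 (by exact_mod_cast h3)
  funext i
  exact Fin.ext (le_antisymm (key j k hj hk i) (key k j hk hj i))

/-- The sum over the cells of the grid of bumps with signs `τ`. -/
noncomputable def signedBumps {m : ℕ} (L a h : ℝ) (τ : (Fin d → Fin m) → ℤˣ) (x : Input d) : ℝ :=
  ∑ k, ((τ k : ℤ) : ℝ) * bump L a h (gridCentre h k) x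

/-- The number of bumps that are nonzero at a given point is at most one. -/
theorem sum_bump_ne_zero_le_one {m : ℕ} (hh : 0 < h) (x : Input d) :
    ∑ k : Fin d → Fin m, (if bump L a h (gridCentre h k) x ≠ 0 then (1 : ℝ) else 0) ≤ 1 := by
  rw [Finset.sum_boole]
  have : (Finset.univ.filter fun k : Fin d → Fin m =>
      bump L a h (gridCentre h k) x ≠ 0).card ≤ 1 := by
    refine Finset.card_le_one.2 fun j hj k hk => gridCentre_disjoint hh x j k ?_ ?_
    · exact norm_sub_lt_of_bump_ne_zero (Finset.mem_filter.1 hj).2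
    · exact norm_sub_lt_of_bump_ne_zero (Finset.mem_filter.1 hk).2
  exact_mod_cast this

theorem abs_sign (u : ℤˣ) : |((u : ℤ) : ℝ)| = 1 := by
  rcases Int.units_eq_one_or u with h | h <;> simp [h]

theorem abs_signedBumps_le {m : ℕ} (hL : 0 ≤ L) (hh : 0 < h) (τ : (Fin d → Fin m) → ℤˣ)
    (x : Input d) : |signedBumps L a h τ x| ≤ L * h ^ a := by
  calc |signedBumps L a h τ x|
      ≤ ∑ k, |((τ k : ℤ) : ℝ) * bump L a h (gridCentre h k) x| := Finset.abs_sum_le_sum_abs _ _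
    _ ≤ ∑ k, (if bump L a h (gridCentre h k) x ≠ 0 then (1 : ℝ) else 0) * (L * h ^ a) := by
        refine Finset.sum_le_sum fun k _ => ?_
        rw [abs_mul, abs_sign, one_mul, abs_of_nonneg (bump_nonneg hL hh _ _)]
        split_ifs with hk
        · rw [one_mul]; exact bump_le hL hh _ _
        · push Not at hk; simp [hk]
    _ ≤ 1 * (L * h ^ a) := by
        rw [← Finset.sum_mul]
        exact mul_le_mul_of_nonneg_right (sum_bump_ne_zero_le_one hh x) (by positivity)
    _ = L * h ^ a := one_mul _

/-- A bound on the oscillation of each single bump gives twice that bound for the signed sum, since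
at most one bump is nonzero at each of the two points. -/
theorem abs_signedBumps_sub_le {m : ℕ} (hh : 0 < h) (τ : (Fin d → Fin m) → ℤˣ)
    (x y : Input d) {C : ℝ} (hC : 0 ≤ C)
    (hxy : ∀ k : Fin d → Fin m,
      |bump L a h (gridCentre h k) x - bump L a h (gridCentre h k) y| ≤ C) :
    |signedBumps L a h τ x - signedBumps L a h τ y| ≤ 2 * C := by
  rw [signedBumps, signedBumps, ← Finset.sum_sub_distrib]
  calc _ ≤ ∑ k, |((τ k : ℤ) : ℝ) * bump L a h (gridCentre h k) x -
          ((τ k : ℤ) : ℝ) * bump L a h (gridCentre h k) y| := Finset.abs_sum_le_sum_abs _ _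
    _ ≤ ∑ k : Fin d → Fin m, ((if bump L a h (gridCentre h k) x ≠ 0 then (1 : ℝ) else 0) +
          (if bump L a h (gridCentre h k) y ≠ 0 then (1 : ℝ) else 0)) * C := by
        refine Finset.sum_le_sum fun k _ => ?_
        rw [← mul_sub, abs_mul, abs_sign, one_mul]
        have := hxy k
        split_ifs with h1 h2 h2
        · linarith
        · linarith
        · linarith
        · push Not at h1 h2; simp [h1, h2]
    _ ≤ (1 + 1) * C := by
        rw [← Finset.sum_mul, Finset.sum_add_distrib]
        exact mul_le_mul_of_nonneg_right (add_le_add (sum_bump_ne_zero_le_one hh x)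
          (sum_bump_ne_zero_le_one hh y)) hC
    _ = 2 * C := by ring

theorem signedBumps_eq_zero {m : ℕ} (hh : 0 < h) (τ : (Fin d → Fin m) → ℤˣ) {x : Input d}
    {i : Fin d} (hx : 2 * m * h ≤ x i) : signedBumps L a h τ x = 0 := by
  refine Finset.sum_eq_zero fun k _ => ?_
  by_contra hne
  exact absurd (mem_Ioo_zero_of_norm_sub_gridCentre_lt hh
    (norm_sub_lt_of_bump_ne_zero (right_ne_zero_of_mul hne)) i).2 (not_lt.2 hx)

end Bump

/-! ### A regression function with prescribed local Hölder exponents -/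

theorem abs_rpow_sub_rpow_le_abs_sub_rpow {p q a : ℝ} (hp : 0 ≤ p) (hq : 0 ≤ q) (ha : 0 ≤ a)
    (ha1 : a ≤ 1) : |p ^ a - q ^ a| ≤ |p - q| ^ a := by
  wlog hqp : q ≤ p generalizing p q
  · rw [abs_sub_comm, abs_sub_comm p]
    exact this hq hp (le_of_not_ge hqp)
  have h1 := Real.rpow_add_le_add_rpow hq (sub_nonneg.2 hqp) ha ha1
  rw [add_sub_cancel] at h1
  rw [abs_of_nonneg (sub_nonneg.2 (Real.rpow_le_rpow hq hqp ha)), abs_of_nonneg (sub_nonneg.2 hqp)]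
  linarith

theorem abs_rpow_sub_rpow_le_mul {p q δ a : ℝ} (hδ : 0 < δ) (hp : δ ≤ p) (hq : δ ≤ q) (ha : 0 ≤ a)
    (ha1 : a ≤ 1) : |p ^ a - q ^ a| ≤ δ ^ (a - 1) * |p - q| := by
  wlog hqp : q ≤ p generalizing p q
  · rw [abs_sub_comm, abs_sub_comm p]
    exact this hq hp (le_of_not_ge hqp)
  have hq0 : 0 < q := hδ.trans_le hq
  rw [abs_of_nonneg (sub_nonneg.2 (Real.rpow_le_rpow hq0.le hqp ha)),
    abs_of_nonneg (sub_nonneg.2 hqp)]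
  have h1 : p ^ a ≤ q ^ (a - 1) * p := by
    have h2 : p ^ (a - 1) ≤ q ^ (a - 1) := Real.rpow_le_rpow_of_nonpos hq0 hqp (by linarith)
    calc p ^ a = p ^ (a - 1) * p := by rw [← Real.rpow_add_one (hq0.trans_le hqp).ne']; simp
      _ ≤ _ := mul_le_mul_of_nonneg_right h2 (hq0.le.trans hqp)
  have h3 : q ^ a = q ^ (a - 1) * q := by rw [← Real.rpow_add_one hq0.ne']; simp
  have h4 : q ^ (a - 1) ≤ δ ^ (a - 1) := Real.rpow_le_rpow_of_nonpos hδ hq (by linarith)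
  nlinarith [mul_le_mul_of_nonneg_right h4 (sub_nonneg.2 hqp)]

/-- A sum of one-sided powers of the distance to the faces `x i = (1 + b k) / 2` of the cubes. The
`k`-th term is singular, with exponent `α k`, on that face of the `k`-th cube, which lies outside
the smaller cubes. -/
noncomputable def faceSum {d K : ℕ} (b α : Fin K → ℝ) (i : Fin d) (x : Input d) : ℝ :=
  ∑ k, (max 0 ((1 + b k) / 2 - x i)) ^ α k

section FaceSum

variable {d K : ℕ} {b α : Fin K → ℝ}

theorem measurable_faceSum (i : Fin d) : Measurable (faceSum b α i) := by
  unfold faceSum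
  fun_prop

theorem abs_apply_sub_le_norm (x y : Input d) (i : Fin d) : |x i - y i| ≤ ‖x - y‖ := by
  simpa using PiLp.norm_apply_le (x - y) i

theorem exists_holderOn_faceSum_term (hb_anti : StrictAnti b) (hb_le : ∀ k, b k ≤ 1)
    (hα_mono : StrictMono α) (hα_mem : ∀ k, α k ∈ Set.Ioc (0 : ℝ) 1) (i : Fin d) (k k' : Fin K) :
    ∃ C : ℝ, 0 ≤ C ∧
      HolderOn C (α k) (fun x => (max 0 ((1 + b k') / 2 - x i)) ^ α k') (centeredCube d (b k)) := by
  obtain ⟨hα0, hα1⟩ := hα_mem k'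
  have hdist {x y : Input d} (hx : x ∈ centeredCube d (b k)) (hy : y ∈ centeredCube d (b k)) :
      |x i - y i| ≤ 1 := by
    have := hb_le k
    obtain ⟨h1, h2⟩ := hx i
    obtain ⟨h3, h4⟩ := hy i
    rw [abs_le]
    constructor <;> linarith
  have hpow {x y : Input d} : |x i - y i| ^ α k ≤ ‖x - y‖ ^ α k :=
    Real.rpow_le_rpow (abs_nonneg _) (abs_apply_sub_le_norm x y i) (hα_mem k).1.le
  rcases le_or_gt k k' with hk | hk
  · refine ⟨1, zero_le_one, fun x hx y hy => ?_⟩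
    rw [one_mul]
    have h1 : |max 0 ((1 + b k') / 2 - x i) - max 0 ((1 + b k') / 2 - y i)| ≤ |x i - y i| := by
      refine (abs_max_sub_max_le_max _ _ _ _).trans (max_le (by simp) ?_)
      rw [sub_sub_sub_cancel_left, abs_sub_comm]
    calc _ ≤ |max 0 ((1 + b k') / 2 - x i) - max 0 ((1 + b k') / 2 - y i)| ^ α k' :=
          abs_rpow_sub_rpow_le_abs_sub_rpow (le_max_left _ _) (le_max_left _ _) hα0.le hα1
      _ ≤ |x i - y i| ^ α k' := Real.rpow_le_rpow (abs_nonneg _) h1 hα0.le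
      _ ≤ |x i - y i| ^ α k := Real.rpow_le_rpow_of_exponent_ge_of_imp (abs_nonneg _)
          (hdist hx hy) (hα_mono.monotone hk) fun _ h => absurd h hα0.ne'
      _ ≤ _ := hpow
  · -- The singular face of a larger cube has positive distance to the `k`-th cube.
    have hδ : 0 < (b k' - b k) / 2 := by linarith [hb_anti hk]
    refine ⟨((b k' - b k) / 2) ^ (α k' - 1), by positivity, fun x hx y hy => ?_⟩
    have hx2 := (hx i).2
    have hy2 := (hy i).2
    simp only
    rw [max_eq_right (by linarith : 0 ≤ (1 + b k') / 2 - x i),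
      max_eq_right (by linarith : 0 ≤ (1 + b k') / 2 - y i)]
    refine (abs_rpow_sub_rpow_le_mul hδ (by linarith) (by linarith) hα0.le hα1).trans ?_
    rw [sub_sub_sub_cancel_left, abs_sub_comm]
    refine mul_le_mul_of_nonneg_left (le_trans ?_ hpow) (by positivity)
    calc |x i - y i| = |x i - y i| ^ (1 : ℝ) := (Real.rpow_one _).symm
      _ ≤ _ := Real.rpow_le_rpow_of_exponent_ge_of_imp (abs_nonneg _)
          (hdist hx hy) (hα_mem k).2 fun _ h => absurd h one_ne_zero

theorem exists_holderOn_faceSum (hb_anti : StrictAnti b) (hb_le : ∀ k, b k ≤ 1)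
    (hα_mono : StrictMono α) (hα_mem : ∀ k, α k ∈ Set.Ioc (0 : ℝ) 1) (i : Fin d) :
    ∃ C : ℝ, 0 ≤ C ∧ ∀ k, HolderOn C (α k) (faceSum b α i) (centeredCube d (b k)) := by
  choose C hC0 hC using fun k k' =>
    exists_holderOn_faceSum_term hb_anti hb_le hα_mono hα_mem i k k'
  have hk (k : Fin K) : HolderOn (∑ k', C k k') (α k) (faceSum b α i) (centeredCube d (b k)) := by
    intro x hx y hy
    rw [faceSum, faceSum, ← Finset.sum_sub_distrib, Finset.sum_mul]
    exact (Finset.abs_sum_le_sum_abs _ _).trans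
      (Finset.sum_le_sum fun k' _ => hC k k' x hx y hy)
  have hnn (k : Fin K) : 0 ≤ ∑ k', C k k' := Finset.sum_nonneg fun k' _ => hC0 k k'
  refine ⟨∑ k, ∑ k', C k k', Finset.sum_nonneg fun k _ => hnn k, fun k x hx y hy => ?_⟩
  exact (hk k x hx y hy).trans (mul_le_mul_of_nonneg_right
    (Finset.single_le_sum (f := fun k => ∑ k', C k k') (fun k _ => hnn k) (Finset.mem_univ k))
    (by positivity))

theorem abs_faceSum_le (hb_le : ∀ k, b k ≤ 1) (hα_mem : ∀ k, α k ∈ Set.Ioc (0 : ℝ) 1)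
    (i : Fin d) {x : Input d} (hx : x ∈ unitCube d) : |faceSum b α i x| ≤ K := by
  rw [faceSum, abs_of_nonneg (Finset.sum_nonneg fun k _ => by positivity)]
  calc _ ≤ ∑ _k : Fin K, (1 : ℝ) := Finset.sum_le_sum fun k _ =>
        Real.rpow_le_one (le_max_left _ _)
          (max_le zero_le_one (by linarith [hb_le k, (hx i).1])) (hα_mem k).1.le
    _ = K := by simp

/-- All terms of `faceSum` decrease in the `i`-th coordinate, so on moving a distance `t` away from
the singular face of the `k`-th cube the sum grows by at least `t ^ α k`. -/
theorem rpow_le_faceSum_sub (hα_mem : ∀ k, α k ∈ Set.Ioc (0 : ℝ) 1) (i : Fin d) (k : Fin K)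
    {x y : Input d} {t : ℝ} (ht : 0 ≤ t) (hx : x i = (1 + b k) / 2)
    (hy : y i = (1 + b k) / 2 - t) : t ^ α k ≤ faceSum b α i y - faceSum b α i x := by
  rw [faceSum, faceSum, ← Finset.sum_sub_distrib, hx, hy]
  refine le_trans (le_of_eq ?_) (Finset.single_le_sum (f := fun k' =>
    max 0 ((1 + b k') / 2 - ((1 + b k) / 2 - t)) ^ α k' -
      max 0 ((1 + b k') / 2 - (1 + b k) / 2) ^ α k') (fun k' _ => ?_) (Finset.mem_univ k))
  · simp [Real.zero_rpow (hα_mem k).1.ne', ht]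
  · exact sub_nonneg.2 (Real.rpow_le_rpow (le_max_left _ _)
      (max_le_max le_rfl (by linarith)) (hα_mem k').1.le)

theorem le_of_forall_mul_rpow_le {η c a e t₀ : ℝ} (hη : 0 < η) (hc : 0 < c) (ht₀ : 0 < t₀)
    (h : ∀ t, 0 < t → t ≤ t₀ → η * t ^ e ≤ c * t ^ a) : a ≤ e := by
  by_contra! hlt
  have hpos : 0 < a - e := sub_pos.2 hlt
  obtain ⟨t, ht, htt₀, ht'⟩ : ∃ t, 0 < t ∧ t ≤ t₀ ∧ t ^ (a - e) ≤ η / (2 * c) := by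
    refine ⟨min t₀ ((η / (2 * c)) ^ (a - e)⁻¹), by positivity, min_le_left _ _, ?_⟩
    calc _ ≤ ((η / (2 * c)) ^ (a - e)⁻¹) ^ (a - e) :=
          Real.rpow_le_rpow (by positivity) (min_le_right _ _) hpos.le
      _ = _ := by rw [← Real.rpow_mul (by positivity), inv_mul_cancel₀ hpos.ne', Real.rpow_one]
  have h1 := h t ht htt₀
  have h2 : t ^ a = t ^ (a - e) * t ^ e := by rw [← Real.rpow_add ht]; simp
  have h3 : 0 < t ^ e := by positivity
  have h4 : η ≤ c * t ^ (a - e) := by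
    rw [h2, ← mul_assoc] at h1
    exact le_of_mul_le_mul_right h1 h3
  have h5 : c * t ^ (a - e) ≤ η / 2 := by
    calc c * t ^ (a - e) ≤ c * (η / (2 * c)) := mul_le_mul_of_nonneg_left ht' hc.le
      _ = η / 2 := by field_simp
  linarith

/-- Adding to a multiple of `faceSum` a Hölder continuous perturbation that vanishes near the
singular faces does not change the local Hölder exponents. -/
theorem localHolderExponent_faceSum_add (hb_pos : ∀ k, 0 < b k)
    (hα_mem : ∀ k, α k ∈ Set.Ioc (0 : ℝ) 1) (i : Fin d) {η cL : ℝ} (hη : 0 < η) (hcL : 0 < cL)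
    {g : Input d → ℝ} (hg : ∀ x : Input d, 1 / 2 ≤ x i → g x = 0) (k : Fin K)
    (hH : HolderOn cL (α k) (fun x => η * faceSum b α i x + g x) (centeredCube d (b k))) :
    localHolderExponent (centeredCube d (b k)) (fun x => η * faceSum b α i x + g x) = α k := by
  refine IsGreatest.csSup_eq ⟨⟨hα_mem k, cL, hcL, hH⟩, ?_⟩
  rintro a ⟨-, c, hc, hHc⟩
  refine le_of_forall_mul_rpow_le hη hc (half_pos (hb_pos k)) fun t ht htb => ?_
  have hbk := hb_pos k
  set x : Input d := WithLp.toLp 2 fun _ => (1 + b k) / 2 with hx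
  set y : Input d := x - EuclideanSpace.single i t with hy
  have hxi (j : Fin d) : x j = (1 + b k) / 2 := rfl
  have hyi : y i = (1 + b k) / 2 - t := by simp [hy, hx]
  have hyj (j : Fin d) (hj : j ≠ i) : y j = (1 + b k) / 2 := by simp [hy, hx, hj]
  have hxB : x ∈ centeredCube d (b k) := fun j => by rw [hxi]; constructor <;> linarith
  have hyB : y ∈ centeredCube d (b k) := fun j => by
    by_cases hj : j = i
    · rw [hj, hyi]; constructor <;> linarith
    · rw [hyj j hj]; constructor <;> linarith
  have hnorm : ‖y - x‖ = t := by simp [hy, abs_of_pos ht]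
  have h1 := hHc y hyB x hxB
  beta_reduce at h1
  rw [hnorm, hg y (by rw [hyi]; linarith), hg x (by rw [hxi]; linarith), add_zero, add_zero,
    ← mul_sub] at h1
  exact (mul_le_mul_of_nonneg_left (rpow_le_faceSum_sub hα_mem i k ht.le (hxi i) hyi) hη.le).trans
    ((le_abs_self _).trans h1)

end FaceSum

/-! ### Regression models with two-point noise -/

/-- The noise distribution that takes the values `σ` and `-σ` with probability `1 / 2` each. -/
noncomputable def signNoise (σ : ℝ) : Measure ℝ :=
  (2⁻¹ : ℝ≥0∞) • Measure.dirac σ + (2⁻¹ : ℝ≥0∞) • Measure.dirac (-σ)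

instance isProbabilityMeasure_signNoise (σ : ℝ) : IsProbabilityMeasure (signNoise σ) :=
  ⟨by simp [signNoise, ENNReal.inv_two_add_inv_two]⟩

theorem ae_signNoise_abs_le {σ : ℝ} (hσ : 0 < σ) : ∀ᵐ e ∂(signNoise σ), |e| ≤ σ := by
  rw [signNoise, ae_add_measure_iff]
  constructor <;> refine Measure.ae_smul_measure ?_ _ <;> rw [ae_dirac_eq] <;>
    simp [abs_of_pos hσ]

theorem integral_signNoise (σ : ℝ) (f : ℝ → ℝ) :
    ∫ e, f e ∂(signNoise σ) = (f σ + f (-σ)) / 2 := by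
  have h (a : ℝ) : Integrable f ((2⁻¹ : ℝ≥0∞) • Measure.dirac a) :=
    (integrable_dirac (by simp)).smul_measure (by simp)
  rw [signNoise, integral_add_measure (h _) (h _), integral_smul_measure, integral_smul_measure,
    integral_dirac, integral_dirac]
  simp
  ring

theorem memLp_signNoise {σ : ℝ} (hσ : 0 < σ) : MemLp id 2 (signNoise σ) :=
  MemLp.of_bound aestronglyMeasurable_id σ (ae_signNoise_abs_le hσ)

theorem isRegressionModel_signNoise {d : ℕ} {M σ : ℝ} (hσ : 0 < σ) {f : Input d → ℝ}
    (hf : Measurable f) (hfM : ∀ x ∈ unitCube d, |f x| ≤ M - σ) :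
    IsRegressionModel M σ f (regressionLaw f (signNoise σ)) := by
  refine ⟨hf, ⟨signNoise σ, inferInstance, memLp_signNoise hσ, ?_, ?_, rfl⟩, ?_⟩
  · simp [integral_signNoise]
  · simp [integral_signNoise]
  · rw [regressionLaw, ae_map_iff (measurable_regressionMap hf).aemeasurable
      (measurable_snd measurableSet_Icc)]
    have h1 : ∀ᵐ p ∂((uniformLaw d).prod (signNoise σ)), p.1 ∈ unitCube d :=
      Measure.quasiMeasurePreserving_fst.ae (ae_restrict_mem (measurableSet_unitCube d))
    have h2 : ∀ᵐ p ∂((uniformLaw d).prod (signNoise σ)), |p.2| ≤ σ :=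
      Measure.quasiMeasurePreserving_snd.ae (ae_signNoise_abs_le hσ)
    filter_upwards [h1, h2] with p hp1 hp2
    have h3 := abs_le.1 (hfM _ hp1)
    have h4 := abs_le.1 hp2
    constructor <;> linarith [h3.1, h3.2, h4.1, h4.2]

/-! ### The lower bound at the optimal bump width -/

section TradeOff

variable {d K : ℕ} {b α : Fin K → ℝ}

theorem deltaM_nonneg (hb_anti : StrictAnti b) (hb_pos : ∀ k, 0 < b k) (k : Fin K) :
    0 ≤ deltaM d b k := by
  unfold deltaM
  split_ifs with hk
  · refine sub_nonneg.2 (pow_le_pow_left₀ (hb_pos _).le (hb_anti.antitone ?_) d)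
    exact Fin.le_def.2 (Nat.le_succ _)
  · simpa using (pow_pos (hb_pos k) d).le

/-- The width `h` with `n * h ^ (2 * α + d) = 1` balances the two parts of the trade-off, and for
`h ≤ 1` the smallest exponent dominates. -/
theorem tradeOff_le (hK : 0 < K) (hb_anti : StrictAnti b) (hb_pos : ∀ k, 0 < b k)
    (hα_mono : StrictMono α) {n : ℕ} (hn : 0 < n) {h : ℝ} (hh : 0 < h) (hh1 : h ≤ 1)
    (hnh : n * ((h ^ α ⟨0, hK⟩) ^ 2 * h ^ d) = 1) :
    tradeOff d n b α ≤ (1 + ∑ k, deltaM d b k) * (h ^ α ⟨0, hK⟩) ^ 2 := by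
  have hn' : (0 : ℝ) < n := Nat.cast_pos.2 hn
  have hsq (k : Fin K) : h ^ (2 * α k) = (h ^ α k) ^ 2 := by
    rw [mul_comm, ← Nat.cast_two, Real.rpow_mul_natCast hh.le]
  have hbdd : BddBelow (Set.range fun h : Set.Ioi (0 : ℝ) =>
      ((n : ℝ)⁻¹ * ((h : ℝ) ^ d)⁻¹ + ∑ k, deltaM d b k * (h : ℝ) ^ (2 * α k))) := by
    refine ⟨0, ?_⟩
    rintro _ ⟨⟨t, ht⟩, rfl⟩
    have ht : 0 < t := ht
    exact add_nonneg (by positivity) (Finset.sum_nonneg fun k _ =>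
      mul_nonneg (deltaM_nonneg hb_anti hb_pos k) (by positivity))
  refine (ciInf_le hbdd ⟨h, hh⟩).trans ?_
  simp only
  rw [add_mul, one_mul, Finset.sum_mul]
  refine add_le_add (le_of_eq ?_) (Finset.sum_le_sum fun k _ => ?_)
  · have : h ^ d ≠ 0 := by positivity
    field_simp
    linarith
  · refine mul_le_mul_of_nonneg_left ?_ (deltaM_nonneg hb_anti hb_pos k)
    rw [hsq]
    exact pow_le_pow_left₀ (by positivity) (Real.rpow_le_rpow_of_exponent_ge hh hh1
      (hα_mono.monotone (Fin.le_def.2 (Nat.zero_le _)))) 2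

/-- A width between the face of the unit cube and all smaller cubes. -/
theorem exists_margin (hK : 0 < K) (hb_one : b ⟨0, hK⟩ = 1) (hb_anti : StrictAnti b) :
    ∃ r : ℝ, 0 < r ∧ r ≤ 1 / 2 ∧ ∀ k, k ≠ ⟨0, hK⟩ → r ≤ (1 - b k) / 2 := by
  by_cases h1 : 1 < K
  · have hlt : b ⟨1, h1⟩ < 1 := hb_one ▸ hb_anti (Fin.lt_def.2 one_pos)
    refine ⟨min (1 / 2) ((1 - b ⟨1, h1⟩) / 2), lt_min (by norm_num) (by linarith),
      min_le_left _ _, fun k hk => (min_le_right _ _).trans ?_⟩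
    have : b k ≤ b ⟨1, h1⟩ := hb_anti.antitone
      (Fin.le_def.2 (Nat.one_le_iff_ne_zero.2 fun h => hk (Fin.ext h)))
    linarith
  · exact ⟨1 / 2, by norm_num, le_rfl, fun k hk => absurd (Fin.ext (by lia)) hk⟩

/-- Perturbing the multiple `η * faceSum` by signed bumps located between a face of the unit cube
and all smaller cubes gives members of the class. -/
theorem regressionLaw_signedBumps_mem (hd : 0 < d) (hK : 0 < K) (hb_one : b ⟨0, hK⟩ = 1)
    (hb_anti : StrictAnti b) (hb_pos : ∀ k, 0 < b k) (hα_mem : ∀ k, α k ∈ Set.Ioc (0 : ℝ) 1)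
    {M σ cL : ℝ} (hσ : 0 < σ) (hcL : 0 < cL) {r : ℝ} (hr : r ≤ 1 / 2)
    (hrb : ∀ k, k ≠ ⟨0, hK⟩ → r ≤ (1 - b k) / 2)
    {η C : ℝ} (hη : 0 < η)
    (hC : ∀ k, HolderOn C (α k) (faceSum b α (⟨0, hd⟩ : Fin d)) (centeredCube d (b k)))
    (hηC : η * C ≤ cL / 2) (hηK : η * K ≤ (M - σ) / 2) {L h : ℝ} {m : ℕ} (hL : 0 ≤ L)
    (hLc : 4 * L ≤ cL) (hLM : L ≤ (M - σ) / 2) (hh : 0 < h) (hh1 : h ≤ 1) (hmh : 2 * m * h = r)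
    (τ : (Fin d → Fin m) → ℤˣ) :
    regressionLaw (fun x => η * faceSum b α ⟨0, hd⟩ x + signedBumps L (α ⟨0, hK⟩) h τ x)
      (signNoise σ) ∈ localHolderBall d b α M σ cL := by
  have hb_le (k : Fin K) : b k ≤ 1 :=
    hb_one ▸ hb_anti.antitone (Fin.le_def.2 (Nat.zero_le _))
  obtain ⟨ha0, ha1⟩ := hα_mem ⟨0, hK⟩
  have hzero (x : Input d) (hx : r ≤ x ⟨0, hd⟩) : signedBumps L (α ⟨0, hK⟩) h τ x = 0 :=
    signedBumps_eq_zero hh τ (hmh ▸ hx)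
  have hH (k : Fin K) : HolderOn cL (α k)
      (fun x => η * faceSum b α ⟨0, hd⟩ x + signedBumps L (α ⟨0, hK⟩) h τ x)
      (centeredCube d (b k)) := by
    intro x hx y hy
    have h1 : |η * faceSum b α ⟨0, hd⟩ x - η * faceSum b α ⟨0, hd⟩ y| ≤
        cL / 2 * ‖x - y‖ ^ α k := by
      rw [← mul_sub, abs_mul, abs_of_pos hη]
      calc _ ≤ η * (C * ‖x - y‖ ^ α k) := mul_le_mul_of_nonneg_left (hC k x hx y hy) hη.le
        _ = η * C * ‖x - y‖ ^ α k := by ring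
        _ ≤ _ := mul_le_mul_of_nonneg_right hηC (by positivity)
    have h2 : |signedBumps L (α ⟨0, hK⟩) h τ x - signedBumps L (α ⟨0, hK⟩) h τ y| ≤
        cL / 2 * ‖x - y‖ ^ α k := by
      by_cases hk : k = ⟨0, hK⟩
      · rw [hk]
        refine (abs_signedBumps_sub_le hh τ x y (C := L * ‖x - y‖ ^ α ⟨0, hK⟩) (by positivity)
          fun j => abs_bump_sub_le_rpow hL hh ha0.le ha1 _ x y).trans ?_
        rw [← mul_assoc]
        exact mul_le_mul_of_nonneg_right (by linarith) (by positivity)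
      · rw [hzero x ((hrb k hk).trans (hx _).1), hzero y ((hrb k hk).trans (hy _).1), sub_zero,
          abs_zero]
        positivity
    calc _ = |(η * faceSum b α ⟨0, hd⟩ x - η * faceSum b α ⟨0, hd⟩ y) +
          (signedBumps L (α ⟨0, hK⟩) h τ x - signedBumps L (α ⟨0, hK⟩) h τ y)| := by ring_nf
      _ ≤ _ := (abs_add_le _ _).trans (add_le_add h1 h2)
      _ = _ := by ring
  have hmeas : Measurable (signedBumps L (α ⟨0, hK⟩) h τ) :=
    Finset.measurable_sum _ fun k _ => (continuous_bump _).measurable.const_mul _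
  refine ⟨_, isRegressionModel_signNoise hσ
    (((measurable_faceSum _).const_mul η).add hmeas) fun x hx => ?_, fun k => ?_, hH⟩
  · have h1 : |η * faceSum b α ⟨0, hd⟩ x| ≤ (M - σ) / 2 := by
      rw [abs_mul, abs_of_pos hη]
      exact (mul_le_mul_of_nonneg_left (abs_faceSum_le hb_le hα_mem _ hx) hη.le).trans hηK
    have h2 : |signedBumps L (α ⟨0, hK⟩) h τ x| ≤ (M - σ) / 2 :=
      ((abs_signedBumps_le hL hh τ x).trans
        (mul_le_of_le_one_right hL (Real.rpow_le_one hh.le hh1 ha0.le))).trans hLM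
    exact (abs_add_le _ _).trans (by linarith)
  · exact localHolderExponent_faceSum_add hb_pos hα_mem _ hη hcL
      (fun x hx => hzero x (hr.trans hx)) k (hH k)

/-- Every upper bound of the expected excess risk over the signed bumps of radius `h` is at least a
multiple of `h ^ (2 * a)`, provided that the bumps fill a cube of fixed side length `2 * m * h` and
that `n * h ^ (2 * a + d) ≤ 1`. -/
theorem le_of_forall_signedBumps_expectedExcessRisk_le {n T m : ℕ} (hd : 0 < d)
    (w : Fin T → ℝ) {σ : ℝ} (hσ : 0 < σ) {f₀ : Input d → ℝ} (hf₀ : Measurable f₀)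
    {L a h : ℝ} (hL : 0 ≤ L) (hh : 0 < h) (hmh : 2 * m * h ≤ 1)
    (hnh : n * ((h ^ a) ^ 2 * h ^ d) ≤ 1) {S : ℝ≥0∞}
    (hS : ∀ τ : (Fin d → Fin m) → ℤˣ, expectedExcessRisk n w
      (regressionLaw (fun x => f₀ x + signedBumps L a h τ x) (signNoise σ)) ≤ S) :
    ENNReal.ofReal (L ^ 2 / 4 * ballVolume d * (2 * m * h / 4) ^ d /
      (1 + L ^ 2 * ballVolume d / σ ^ 2) * (h ^ a) ^ 2) ≤ S := by
  have hv := ballVolume_pos d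
  have hsub (k : Fin d → Fin m) : Metric.ball (gridCentre h k) h ⊆ unitCube d := by
    intro x hx i
    have := mem_Ioo_zero_of_norm_sub_gridCentre_lt hh (mem_ball_iff_norm.1 hx) i
    exact ⟨this.1.le, this.2.le.trans hmh⟩
  refine le_trans (le_of_eq ?_) (le_of_forall_sign_expectedExcessRisk_le w hσ (memLp_signNoise hσ)
    (by simp [integral_signNoise]) (by simp [integral_signNoise]) hf₀
    (φ := fun k : Fin d → Fin m => bump L a h (gridCentre h k))
    (fun k => (continuous_bump _).measurable) (fun k => integrable_bump_sq hL hh _)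
    (fun x j k hj hk => gridCentre_disjoint hh x j k (norm_sub_lt_of_bump_ne_zero hj)
      (norm_sub_lt_of_bump_ne_zero hk)) (V := L ^ 2 * ballVolume d / σ ^ 2) (by positivity)
    (fun k => le_integral_bump_sq hd hL hh (hsub k)) (fun k => ?_) hS)
  · congr 1
    simp only [Fintype.card_fun, Fintype.card_fin, Nat.cast_pow, mul_pow, div_pow]
    have h4 : (4 : ℝ) ^ d = 2 ^ d * 2 ^ d := by rw [← mul_pow]; norm_num
    rw [h4]
    field_simp
    ring
  · calc n * ∫ x, bump L a h (gridCentre h k) x ^ 2 ∂(uniformLaw d)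
        ≤ n * ((L * h ^ a) ^ 2 * (h ^ d * ballVolume d)) :=
          mul_le_mul_of_nonneg_left (integral_bump_sq_le hd hL hh _) (Nat.cast_nonneg n)
      _ = n * ((h ^ a) ^ 2 * h ^ d) * (L ^ 2 * ballVolume d) := by ring
      _ ≤ 1 * (L ^ 2 * ballVolume d) := mul_le_mul_of_nonneg_right hnh (by positivity)
      _ = L ^ 2 * ballVolume d / σ ^ 2 * σ ^ 2 := by field_simp

theorem exists_forall_tradeOff_le_minimaxRisk_localHolderBall (hd : 0 < d) (hK : 0 < K)
    (hb_one : b ⟨0, hK⟩ = 1) (hb_anti : StrictAnti b) (hb_pos : ∀ k, 0 < b k)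
    (hα_mono : StrictMono α) (hα_mem : ∀ k, α k ∈ Set.Ioc (0 : ℝ) 1)
    {M σ cL : ℝ} (hσ : 0 < σ) (hσM : σ < M) (hcL : 0 < cL) :
    ∃ cE : ℝ, 0 < cE ∧ ∀ n : ℕ, 0 < n → ENNReal.ofReal (cE * tradeOff d n b α) ≤
      minimaxRisk n (localHolderBall d b α M σ cL) := by
  have hb_le (k : Fin K) : b k ≤ 1 :=
    hb_one ▸ hb_anti.antitone (Fin.le_def.2 (Nat.zero_le _))
  obtain ⟨r, hr0, hr, hrb⟩ := exists_margin hK hb_one hb_anti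
  obtain ⟨C, hC0, hC⟩ := exists_holderOn_faceSum hb_anti hb_le hα_mono hα_mem (⟨0, hd⟩ : Fin d)
  have hMσ : 0 < M - σ := sub_pos.2 hσM
  have hK' : (0 : ℝ) < K := Nat.cast_pos.2 hK
  obtain ⟨η, hη, hηC, hηK⟩ : ∃ η : ℝ, 0 < η ∧ η * C ≤ cL / 2 ∧ η * K ≤ (M - σ) / 2 := by
    refine ⟨min (cL / 2 / (C + 1)) ((M - σ) / 2 / K), by positivity, ?_, ?_⟩
    · calc _ ≤ cL / 2 / (C + 1) * (C + 1) :=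
            mul_le_mul (min_le_left _ _) (by linarith) hC0 (by positivity)
        _ = _ := by field_simp
    · calc _ ≤ (M - σ) / 2 / K * K := mul_le_mul_of_nonneg_right (min_le_right _ _) hK'.le
        _ = _ := by field_simp
  obtain ⟨L, hL, hLc, hLM⟩ : ∃ L : ℝ, 0 < L ∧ 4 * L ≤ cL ∧ L ≤ (M - σ) / 2 := by
    refine ⟨min (cL / 4) ((M - σ) / 2), by positivity, ?_, min_le_right _ _⟩
    linarith [min_le_left (cL / 4) ((M - σ) / 2)]
  set a := α ⟨0, hK⟩ with ha
  obtain ⟨ha0, ha1⟩ : 0 < a ∧ a ≤ 1 := hα_mem ⟨0, hK⟩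
  have hv := ballVolume_pos d
  set A : ℝ := L ^ 2 / 4 * ballVolume d * (r / 4) ^ d / (1 + L ^ 2 * ballVolume d / σ ^ 2) with hA
  have hA0 : 0 < A := by positivity
  have hΔ : 0 ≤ ∑ k, deltaM d b k := Finset.sum_nonneg fun k _ => deltaM_nonneg hb_anti hb_pos k
  refine ⟨A * ((r / 4) ^ a) ^ 2 / (1 + ∑ k, deltaM d b k), by positivity, fun n hn => ?_⟩
  have hn1 : (1 : ℝ) ≤ n := Nat.one_le_cast.2 hn
  have hn0 : (0 : ℝ) < n := Nat.cast_pos.2 hn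
  have he : 0 < a * 2 + d := by positivity
  -- The width `h₀` balances bias and variance; the bump radius `h` is of the same order, rounded so
  -- that an integral number of bumps fits into the margin.
  obtain ⟨h₀, hh₀, hh₀1, hnh₀⟩ : ∃ h₀ : ℝ, 0 < h₀ ∧ h₀ ≤ 1 ∧ n * ((h₀ ^ a) ^ 2 * h₀ ^ d) = 1 := by
    refine ⟨(n : ℝ) ^ (-(a * 2 + d)⁻¹), by positivity,
      Real.rpow_le_one_of_one_le_of_nonpos hn1 (by simp only [Left.neg_nonpos_iff]; positivity), ?_⟩
    have hpos : 0 < (n : ℝ) ^ (-(a * 2 + d)⁻¹) := by positivity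
    rw [← Real.rpow_mul_natCast hpos.le, ← Real.rpow_natCast _ d, ← Real.rpow_add hpos,
      ← Real.rpow_mul hn0.le, Nat.cast_two, neg_mul, inv_mul_cancel₀ he.ne', Real.rpow_neg_one,
      mul_inv_cancel₀ hn0.ne']
  obtain ⟨m, hm, hmh₀, hmh₀'⟩ : ∃ m : ℕ, (0 : ℝ) < m ∧ 1 ≤ m * h₀ ∧ m * h₀ ≤ 2 := by
    have h1 : 1 / h₀ ≤ ⌈1 / h₀⌉₊ := Nat.le_ceil _
    have h2 : (⌈1 / h₀⌉₊ : ℝ) < 1 / h₀ + 1 := Nat.ceil_lt_add_one (by positivity)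
    refine ⟨⌈1 / h₀⌉₊, lt_of_lt_of_le (by positivity) h1, (div_le_iff₀ hh₀).1 h1, ?_⟩
    calc _ ≤ (1 / h₀ + 1) * h₀ := mul_le_mul_of_nonneg_right h2.le hh₀.le
      _ = 1 + h₀ := by field_simp
      _ ≤ 2 := by linarith
  obtain ⟨h, hh⟩ : ∃ h : ℝ, h = r / (2 * m) := ⟨_, rfl⟩
  have hh0 : 0 < h := hh ▸ by positivity
  have hmh : 2 * m * h = r := by rw [hh]; field_simp
  have hhle : h ≤ h₀ := by
    rw [hh, div_le_iff₀ (by positivity)]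
    nlinarith
  have hlo : r / 4 * h₀ ≤ h := by
    rw [hh, le_div_iff₀ (by positivity)]
    nlinarith
  have hh1 : h ≤ 1 := hhle.trans hh₀1
  have hnh : n * ((h ^ a) ^ 2 * h ^ d) ≤ 1 := by
    rw [← hnh₀]
    gcongr
  unfold minimaxRisk
  refine le_iInf fun T => le_iInf fun _ => le_iInf fun w => le_iInf fun _ => ?_
  have hmain := le_of_forall_signedBumps_expectedExcessRisk_le (n := n) (a := a) (m := m) hd w hσ
    ((measurable_faceSum (b := b) (α := α) ⟨0, hd⟩).const_mul η) hL.le hh0 (by linarith) hnh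
    (S := ⨆ P ∈ localHolderBall d b α M σ cL, expectedExcessRisk n w P)
    fun τ => le_iSup₂_of_le _ (regressionLaw_signedBumps_mem hd hK hb_one hb_anti hb_pos hα_mem hσ
      hcL hr hrb hη hC hηC hηK hL.le hLc hLM hh0 hh1 hmh τ) le_rfl
  rw [hmh, ← hA] at hmain
  refine le_trans (ENNReal.ofReal_le_ofReal ?_) hmain
  calc A * ((r / 4) ^ a) ^ 2 / (1 + ∑ k, deltaM d b k) * tradeOff d n b α
      ≤ A * ((r / 4) ^ a) ^ 2 / (1 + ∑ k, deltaM d b k) *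
          ((1 + ∑ k, deltaM d b k) * (h₀ ^ a) ^ 2) :=
        mul_le_mul_of_nonneg_left (tradeOff_le hK hb_anti hb_pos hα_mono hn hh₀ hh₀1 hnh₀)
          (by positivity)
    _ = A * ((r / 4 * h₀) ^ a) ^ 2 := by
        rw [Real.mul_rpow (by positivity) hh₀.le]
        field_simp
    _ ≤ A * (h ^ a) ^ 2 := by gcongr

end TradeOff

end PEHT

theorem mainTheorem3 (d K : ℕ) (hd : 0 < d) (hK : 0 < K) (b α : Fin K → ℝ)
    (hb_one : b ⟨0, hK⟩ = 1) (hb_anti : StrictAnti b) (hb_pos : ∀ k, 0 < b k)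
    (hα_mono : StrictMono α) (hα_mem : ∀ k, α k ∈ Set.Ioc (0 : ℝ) 1)
    (M σ : ℝ) (hσ : 0 < σ) (hσM : σ < M) :
    (∃ cE : ℝ, 0 < cE ∧ ∀ n : ℕ, 0 < n →
      ENNReal.ofReal (cE * PEHT.tradeOff d n b α) ≤
        PEHT.minimaxRisk n (PEHT.localHolderClass d b α M σ)) ∧
    (∀ cL : ℝ, 0 < cL → ∃ cE : ℝ, 0 < cE ∧ ∀ n : ℕ, 0 < n →
      ENNReal.ofReal (cE * PEHT.tradeOff d n b α) ≤
        PEHT.minimaxRisk n (PEHT.localHolderBall d b α M σ cL)) := by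
  have hball (cL : ℝ) (hcL : 0 < cL) :=
    PEHT.exists_forall_tradeOff_le_minimaxRisk_localHolderBall hd hK hb_one hb_anti hb_pos hα_mono
      hα_mem hσ hσM hcL
  refine ⟨?_, hball⟩
  obtain ⟨cE, hcE, hle⟩ := hball 1 one_pos
  refine ⟨cE, hcE, fun n hn => (hle n hn).trans ?_⟩
  have hsub : PEHT.localHolderBall d b α M σ 1 ⊆ PEHT.localHolderClass d b α M σ :=
    fun P ⟨f, hf, hα, _⟩ => ⟨f, hf, hα⟩
  exact iInf_mono fun T => iInf_mono fun _ => iInf_mono fun w => iInf_mono fun _ =>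
    biSup_mono fun P hP => hsub hP
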